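/- Notation. Let $n\ge 1$, $\widehat f(\xi)=\int_{\mathbb R^n} f(x)e^{-2\pi i x\cdot\xi}\,dx$, $B(0,r)=\{x\in\mathbb R^n:|x|<r\}$, $A_{a,b}=\{x\in\mathbb R^n: a<|x|<b\}$, let $\operatorname{supp}$ denote the closed support, and let $$e^{it\Delta}f(x)=\int_{\mathbb R^n}\widehat f(\xi)e^{2\pi i x\cdot\xi-4\pi^2 i t|\xi|^2}\,d\xi$$ be the solution of $i\partial_t u+\Delta u=0$ with initial data $f$. Let $\sigma<\frac1{n+2}$, and let $\theta$ be a Schwartz function on $\mathbb R^n$ with $\operatorname{supp}\widehat\theta\subset A_{4^{-n-3},4\sqrt n}$ and $\widehat\theta=1$ on $A_{4^{-n-2},2\sqrt n}$. Call $\epsilon_1>0$ admissible if for every sufficiently large $R$ one has $$\Big|\int e^{2\pi i[(x-\frac{2t\xi'}{R})\cdot\xi-\frac tR|\xi|^2]}\theta(\xi)\,d\xi-1\Big|<\frac12$$ for all $x\in A_{4^{-n-2},2\sqrt n}$, $t\in(0,1)$ and $\xi'\in\mathbb R^n$ with $|\xi'|\le\epsilon_1R$. For $R>0$ let $$\Omega=(R^{1-\sigma}\mathbb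 Z^n)\cap B(0,\epsilon_1R),\qquad \widehat{u_{0,R}}(\xi)=\sum_{\xi'\in\Omega}\theta(\xi-\xi'),\qquad u_R(x,t)=e^{it\Delta}u_{0,R}(x),$$ and let $v_R(x,t)=t^{-n/2}\,\overline{u_R}(\frac xt,\frac1t)\,e^{i|x|^2/(4t)}$, $t>0$, be the pseudoconformal transform. Statement. Admissible $\epsilon_1$ exist, and for every admissible $\epsilon_1$ there are constants $K,c,C>0$, depending only on $n,\sigma,\theta,\epsilon_1$, such that for every sufficiently large $R$ for which $R^\sigma$ is an integer the following holds. There is a Schwartz function $v_{0,R}$ with $v_R(x,t)=e^{it\Delta}v_{0,R}(x)$ for all $t>0$ and $x\in\mathbb R^n$, and $v_{0,R}(x)=\lim_{t\to0^+}v_R(x,t)$ for all $x$; moreover $$\Big|\Big\{x\in B(0,R):\ \sup_{0<t\le KR}|v_R(x,t)|\ge c\,R^{\sigma n-\frac n2}\Big\}\Big|\ge c\,R^n,$$ $$c\,R^{\frac{\sigma n}2}\le\|v_{0,R}\|_{L^2(\mathbb R^n)}\le C\,R^{\frac{\sigma n}2},$$ $$\frac{\big\|\sup_{0<t\le KR}|v_R(x,t)|\big\|_{L^2(B(0,R))}}{\|v_{0,R}\|_{L^2(\mathbb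 R^n)}}\ge c\,R^{\frac{\sigma n}2},$$ $$\operatorname{supp}\widehat{v_{0,R}}\subset\tfrac1{4\pi}\operatorname{supp}u_{0,R}\subset A_{4^{-n-4}/\pi,\ \sqrt n/\pi}.$$ -/

import Mathlib

open Filter Topology MeasureTheory Set
open scoped SchwartzMap FourierTransform RealInnerProductSpace ENNReal Pointwise ComplexConjugate

noncomputable section

/-- Euclidean space `ℝⁿ`. -/
abbrev Rn (n : ℕ) : Type := EuclideanSpace ℝ (Fin n)

/-- The open annulus `A_{a,b} = {x ∈ ℝⁿ : a < |x| < b}`. -/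
def annulus (n : ℕ) (a b : ℝ) : Set (Rn n) := {x | a < ‖x‖ ∧ ‖x‖ < b}

/-- The solution `e^{itΔ} f (x) = ∫ f̂(ξ) e^{2πi x·ξ - 4π² i t |ξ|²} dξ` of `i ∂ₜ u + Δ u = 0` with
initial data `f`. Here `f̂(ξ) = ∫ f(x) e^{-2πi x·ξ} dx`. -/
def schrodingerFlow {n : ℕ} (f : 𝓢(Rn n, ℂ)) (t : ℝ) (x : Rn n) : ℂ :=
  ∫ ξ : Rn n, 𝓕 f ξ *
    Complex.exp (Complex.I * ((2 * Real.pi * ⟪x, ξ⟫ - 4 * Real.pi ^ 2 * t * ‖ξ‖ ^ 2 : ℝ) : ℂ))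

/-- The pseudoconformal transformation
`v(x,t) = t^{-n/2} conj(u(x/t, 1/t)) e^{i|x|²/(4t)}` of a space-time function `u`
(first argument: time), used for `t > 0`. -/
def pseudoconformal {n : ℕ} (u : ℝ → Rn n → ℂ) (t : ℝ) (x : Rn n) : ℂ :=
  ((1 / t ^ ((n : ℝ) / 2) : ℝ) : ℂ) * conj (u (1 / t) (t⁻¹ • x)) *
    Complex.exp (Complex.I * ((‖x‖ ^ 2 / (4 * t) : ℝ) : ℂ))

/-- `θ` is a Schwartz function whose Fourier transform is supported inside
`A_{4^{-n-3}, 4√n}` and equals `1` on `A_{4^{-n-2}, 2√n}`. -/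
structure IsProfile {n : ℕ} (θ : 𝓢(Rn n, ℂ)) : Prop where
  support : tsupport (𝓕 θ : 𝓢(Rn n, ℂ)) ⊆ annulus n (1 / 4 ^ (n + 3)) (4 * √(n : ℝ))
  eq_one : ∀ y ∈ annulus n (1 / 4 ^ (n + 2)) (2 * √(n : ℝ)), 𝓕 θ y = 1

/-- The radius parameter `ε₁` is admissible for `θ`: for all large `R`, every
`x ∈ A_{4^{-n-2}, 2√n}`, every `t ∈ (0,1)` and every `|ξ'| ≤ ε₁ R`,
`|∫ e^{2πi[(x - 2tξ'/R)·ξ - (t/R)|ξ|²]} θ(ξ) dξ - 1| < 1/2`. -/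
def IsAdmissible {n : ℕ} (θ : 𝓢(Rn n, ℂ)) (ε₁ : ℝ) : Prop :=
  0 < ε₁ ∧ ∀ᶠ R : ℝ in atTop,
    ∀ x ∈ annulus n (1 / 4 ^ (n + 2)) (2 * √(n : ℝ)), ∀ t ∈ Ioo (0 : ℝ) 1,
      ∀ ξ' : Rn n, ‖ξ'‖ ≤ ε₁ * R →
        ‖(∫ ξ : Rn n, Complex.exp (Complex.I *
            ((2 * Real.pi * (⟪x - (2 * t / R) • ξ', ξ⟫ - t / R * ‖ξ‖ ^ 2) : ℝ) : ℂ)) * θ ξ) - 1‖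
          < 1 / 2

/-- The frequency set `Ω = (R^{1-σ} ℤⁿ) ∩ B(0, ε₁ R)`. -/
def freqSet (n : ℕ) (σ ε₁ R : ℝ) : Set (Rn n) :=
  {ξ | ∃ k : Fin n → ℤ, ξ = WithLp.toLp 2 fun i => R ^ (1 - σ) * (k i : ℝ)} ∩
    Metric.ball 0 (ε₁ * R)

/-- For `R > 0` the frequency set is finite, so finite sums over it have their usual meaning. -/
theorem freqSet_finite (n : ℕ) (σ ε₁ R : ℝ) (hR : 0 < R) : (freqSet n σ ε₁ R).Finite := by
  have hq : 0 < R ^ (1 - σ) := Real.rpow_pos_of_pos hR _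
  set M : ℤ := ⌈ε₁ * R / R ^ (1 - σ)⌉ with hM
  refine ((Set.finite_Icc (fun _ : Fin n => -M) (fun _ => M)).image
    (fun k => (WithLp.toLp 2 fun i => R ^ (1 - σ) * (k i : ℝ) : Rn n))).subset ?_
  rintro ξ ⟨⟨k, rfl⟩, hk⟩
  refine ⟨k, ?_, rfl⟩
  rw [mem_ball_zero_iff] at hk
  have key : ∀ i, |(k i : ℝ)| ≤ M := by
    intro i
    have h1 := (PiLp.norm_apply_le
      (WithLp.toLp 2 fun i => R ^ (1 - σ) * (k i : ℝ) : Rn n) i).trans hk.le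
    simp only [Real.norm_eq_abs, abs_mul, abs_of_pos hq] at h1
    refine le_trans ?_ (Int.le_ceil _)
    rw [le_div_iff₀ hq]
    linarith
  refine ⟨fun i => ?_, fun i => ?_⟩
  · have := (abs_le.mp (key i)).1
    exact_mod_cast this
  · have := (abs_le.mp (key i)).2
    exact_mod_cast this

/-- The initial data `u_{0,R}`, defined by `û_{0,R}(ξ) = ∑_{ξ' ∈ Ω} θ(ξ - ξ')`. -/
def latticeData {n : ℕ} (θ : 𝓢(Rn n, ℂ)) (σ ε₁ R : ℝ) : 𝓢(Rn n, ℂ) :=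
  𝓕⁻ (∑ᶠ ξ' ∈ freqSet n σ ε₁ R, SchwartzMap.compSubConstCLM ℂ ξ' θ)

/-- `v_R`, the pseudoconformal transformation of `u_R(x,t) = e^{itΔ} u_{0,R}(x)`. -/
def latticeTransform {n : ℕ} (θ : 𝓢(Rn n, ℂ)) (σ ε₁ R : ℝ) : ℝ → Rn n → ℂ :=
  pseudoconformal (schrodingerFlow (latticeData θ σ ε₁ R))

/-- `v` is the solution of the Schrödinger equation on `t > 0` with initial data `v₀`. The limit
determines `v₀` uniquely. -/
structure HasInitialData {n : ℕ} (v : ℝ → Rn n → ℂ) (v₀ : 𝓢(Rn n, ℂ)) : Prop where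
  flow : ∀ t : ℝ, 0 < t → ∀ x, v t x = schrodingerFlow v₀ t x
  limit : ∀ x, Tendsto (fun t => v t x) (𝓝[>] 0) (𝓝 (v₀ x))

/-- The maximal function `sup_{0 < t ≤ τ} |v(x,t)|`, with values in `[0,∞]`. -/
def maximalFn {n : ℕ} (v : ℝ → Rn n → ℂ) (τ : ℝ) (x : Rn n) : ℝ≥0∞ :=
  ⨆ t ∈ Ioc (0 : ℝ) τ, ‖v t x‖ₑ

end

/-! Put q = R^{1-σ} and Q = R^{1-2σ}, so q² = RQ. The flow u_R is a sum over ξ' = qk of plane waves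
times integrals that admissibility keeps within 1/2 of 1 (`schrodingerFlow_latticeData`). At time s
= j/(2πq²) the quadratic phase is 2πj|k|², an integer multiple of 2π. At the point s•x the linear
phase is 2πjα x·k with α = 1/(2πq), so if jαx lies within 1/M of ℤⁿ in each coordinate, all phases
are O(R^σ/M) modulo 2π. For small phases no term cancels another and |u_R(s•x, s)| is at least a
quarter of the number of frequencies, which is about R^{σn}.

Dirichlet's theorem supplies such a j ≤ Mⁿ for every x. Taking M ≈ Q^{1/n} keeps j < Q, and M
dominates R^σ exactly when σ(n+2) < 1. The pseudoconformal transform at time t = 1/s and position x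
evaluates u_R at (s•x, s) with weight t^{-n/2}, so t must be at most of order R, that is, j must be
at least of order Q. Points admitting a smaller j are discarded: each j excludes a proportion of
about (2/M)ⁿ of a cube of side comparable to R, and the union over j ≤ 4⁻ⁿQ leaves at least a
quarter of it (`le_volume_wellSpreadSet`).

The transform acts on the Fourier side by conjugation and dilation by 4π, which gives the initial
data, its support and an L² isometry (`pseudoconformal_eq_schrodingerFlow`). The norm of u_{0,R} is
computed from orthogonality of the exponentials over cubes whose side is a multiple of 1/q. -/

noncomputable section

/-! ### The Fresnel integral and the pseudoconformal transform of Schwartz data -/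

/-- Parseval's identity against a complex Gaussian. -/
theorem integral_fourier_mul_gaussian {n : ℕ} (f : 𝓢(Rn n, ℂ)) {b : ℂ} (hb : 0 < b.re) (y : Rn n) :
    ∫ ξ, 𝓕 f ξ * Complex.exp (-b * ‖ξ‖ ^ 2 + 2 * Real.pi * Complex.I * ⟪y, ξ⟫) =
      (Real.pi / b) ^ ((n : ℂ) / 2) *
        ∫ z, f z * Complex.exp (-(Real.pi ^ 2 * (‖y - z‖ ^ 2 : ℝ) / b)) := by
  have hg := GaussianFourier.integrable_cexp_neg_mul_sq_norm_add (V := Rn n) hb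
    (2 * Real.pi * Complex.I) y
  have key := VectorFourier.integral_fourierIntegral_smul_eq_flip (L := innerₗ (Rn n))
    Real.continuous_fourierChar continuous_inner (f.integrable (μ := volume)) hg
  have h2 : ∀ x, VectorFourier.fourierIntegral Real.fourierChar volume (innerₗ (Rn n)).flip
      (fun v => Complex.exp (-b * ‖v‖ ^ 2 + 2 * Real.pi * Complex.I * ⟪y, v⟫)) x =
      (Real.pi / b) ^ ((n : ℂ) / 2) * Complex.exp (-(Real.pi ^ 2 * (‖y - x‖ ^ 2 : ℝ) / b)) := by
    intro x
    rw [flip_innerₗ]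
    have := fourier_gaussian_innerProductSpace' hb y x
    rw [finrank_euclideanSpace_fin] at this
    refine Eq.trans ?_ (this.trans ?_)
    · rfl
    · congr 2
      push_cast
      ring
  simp only [h2, smul_eq_mul] at key
  rw [← integral_const_mul]
  refine Eq.trans key ?_
  congr 1 with x
  ring

/-- The Fresnel representation of the free Schrödinger evolution. -/
theorem schrodingerFlow_eq_integral {n : ℕ} (f : 𝓢(Rn n, ℂ)) {s : ℝ} (hs : 0 < s) (y : Rn n) :
    schrodingerFlow f s y = (Real.pi / (4 * Real.pi ^ 2 * s * Complex.I)) ^ ((n : ℂ) / 2) *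
      ∫ z, f z * Complex.exp (Complex.I * ((‖y - z‖ ^ 2 / (4 * s) : ℝ) : ℂ)) := by
  have hpi := Real.pi_pos
  -- The Gaussian parameter of the flow is purely imaginary, so a damping ε > 0 is added; dominated
  -- convergence removes it on both sides as ε → 0⁺.
  set B : ℝ → ℂ := fun ε => (ε : ℂ) + 4 * Real.pi ^ 2 * s * Complex.I with hB
  have hBre : ∀ ε, (B ε).re = ε := by
    intro ε
    simp only [hB, Complex.add_re, Complex.ofReal_re]
    have : (4 * (Real.pi : ℂ) ^ 2 * s * Complex.I) = ((4 * Real.pi ^ 2 * s : ℝ) : ℂ) * Complex.I := by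
      push_cast; ring
    rw [this, Complex.re_ofReal_mul]; simp
  have hBc : Continuous B := by fun_prop
  have hB0 : B 0 = 4 * Real.pi ^ 2 * s * Complex.I := by simp [hB]
  have hB0ne : B 0 ≠ 0 := by
    rw [hB0]
    have : (s : ℂ) ≠ 0 := by exact_mod_cast hs.ne'
    simp [this, hpi.ne']
  -- The limiting base lies on the negative imaginary axis, off the branch cut, so the principal
  -- power is continuous there.
  have hslit : (Real.pi : ℂ) / B 0 ∈ Complex.slitPlane := by
    rw [Complex.mem_slitPlane_iff]
    right
    have : (Real.pi : ℂ) / B 0 = ((-(1 / (4 * Real.pi * s)) : ℝ) : ℂ) * Complex.I := by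
      rw [div_eq_iff hB0ne, hB0]
      have : (s : ℂ) ≠ 0 := by exact_mod_cast hs.ne'
      have hp : (Real.pi : ℂ) ≠ 0 := by exact_mod_cast hpi.ne'
      push_cast
      field_simp
      simp
    rw [this, Complex.im_ofReal_mul]
    simp [hpi.ne', hs.ne']
  have hL : Tendsto (fun ε : ℝ => ∫ ξ, 𝓕 f ξ * Complex.exp (-(B ε) * ‖ξ‖ ^ 2 +
      2 * Real.pi * Complex.I * ⟪y, ξ⟫)) (𝓝[>] 0) (𝓝 (schrodingerFlow f s y)) := by
    refine tendsto_integral_filter_of_dominated_convergence (fun ξ => ‖𝓕 f ξ‖) ?_ ?_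
      (𝓕 f).integrable.norm ?_
    · refine Eventually.of_forall fun ε => Continuous.aestronglyMeasurable ?_
      have := (𝓕 f).continuous
      fun_prop
    · filter_upwards [self_mem_nhdsWithin] with ε hε
      refine Eventually.of_forall fun ξ => ?_
      rw [norm_mul, Complex.norm_exp]
      refine mul_le_of_le_one_right (norm_nonneg _) (Real.exp_le_one_iff.mpr ?_)
      have h1 : (-(B ε) * (‖ξ‖ : ℂ) ^ 2 + 2 * Real.pi * Complex.I * (⟪y, ξ⟫ : ℝ)) =
        ((‖ξ‖ ^ 2 : ℝ) : ℂ) * (-(B ε)) + ((2 * Real.pi * ⟪y, ξ⟫ : ℝ) : ℂ) * Complex.I := by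
        push_cast; ring
      rw [h1, Complex.add_re, Complex.re_ofReal_mul, Complex.re_ofReal_mul, Complex.neg_re, hBre]
      simp only [Complex.I_re, mul_zero, add_zero]
      have : 0 < ε := hε
      nlinarith [sq_nonneg ‖ξ‖]
    · refine Eventually.of_forall fun ξ => ?_
      have hc : Continuous fun ε => 𝓕 f ξ * Complex.exp (-(B ε) * ‖ξ‖ ^ 2 +
        2 * Real.pi * Complex.I * ⟪y, ξ⟫) := by fun_prop
      have := (hc.tendsto 0).mono_left (nhdsWithin_le_nhds (s := Ioi 0))
      convert this using 2
      rw [hB0]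
      congr 2
      push_cast
      ring
  have hR : Tendsto (fun ε : ℝ => (Real.pi / B ε) ^ ((n : ℂ) / 2) *
        ∫ z, f z * Complex.exp (-(Real.pi ^ 2 * (‖y - z‖ ^ 2 : ℝ) / B ε))) (𝓝[>] 0)
      (𝓝 ((Real.pi / B 0) ^ ((n : ℂ) / 2) *
        ∫ z, f z * Complex.exp (-(Real.pi ^ 2 * (‖y - z‖ ^ 2 : ℝ) / B 0)))) := by
    refine Tendsto.mul ?_ ?_
    · have : ContinuousAt (fun ε => ((Real.pi : ℂ) / B ε) ^ ((n : ℂ) / 2)) 0 :=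
        ContinuousAt.cpow (continuousAt_const.div hBc.continuousAt hB0ne) continuousAt_const hslit
      exact this.tendsto.mono_left nhdsWithin_le_nhds
    · refine tendsto_integral_filter_of_dominated_convergence (fun z => ‖f z‖) ?_ ?_
        f.integrable.norm ?_
      · refine Eventually.of_forall fun ε => Continuous.aestronglyMeasurable ?_
        have := f.continuous
        fun_prop
      · filter_upwards [self_mem_nhdsWithin] with ε hε
        refine Eventually.of_forall fun ξ => ?_
        rw [norm_mul, Complex.norm_exp]
        refine mul_le_of_le_one_right (norm_nonneg _) (Real.exp_le_one_iff.mpr ?_)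
        have h1 : (-((Real.pi : ℂ) ^ 2 * (‖y - ξ‖ ^ 2 : ℝ) / B ε)) =
          ((-(Real.pi ^ 2 * ‖y - ξ‖ ^ 2) : ℝ) : ℂ) * (B ε)⁻¹ := by
          push_cast; ring
        rw [h1, Complex.re_ofReal_mul, Complex.inv_re, hBre]
        have : 0 < ε := hε
        have h3 : 0 ≤ ε / Complex.normSq (B ε) := div_nonneg this.le (Complex.normSq_nonneg _)
        have h4 : 0 ≤ Real.pi ^ 2 * ‖y - ξ‖ ^ 2 := by positivity
        nlinarith [mul_nonneg h4 h3]
      · refine Eventually.of_forall fun z => ?_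
        have : ContinuousAt (fun ε => f z *
            Complex.exp (-(Real.pi ^ 2 * (‖y - z‖ ^ 2 : ℝ) / B ε))) 0 := by
          refine continuousAt_const.mul (ContinuousAt.cexp (ContinuousAt.neg ?_))
          exact continuousAt_const.div hBc.continuousAt hB0ne
        exact this.tendsto.mono_left nhdsWithin_le_nhds
  have heq := tendsto_nhds_unique (hL.congr' ?_) hR
  · rw [heq, hB0]
    congr 2 with z
    congr 2
    have : (s : ℂ) ≠ 0 := by exact_mod_cast hs.ne'
    have hp : (Real.pi : ℂ) ≠ 0 := by exact_mod_cast hpi.ne'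
    push_cast
    field_simp
    simp
  · filter_upwards [self_mem_nhdsWithin] with ε hε
    exact integral_fourier_mul_gaussian f (by rw [hBre]; exact hε) y

theorem schrodingerFlow_zero {n : ℕ} (f : 𝓢(Rn n, ℂ)) (x : Rn n) : schrodingerFlow f 0 x = f x := by
  conv_rhs => rw [← FourierTransform.fourierInv_fourier_eq (F := 𝓢(Rn n, ℂ)) f]
  rw [SchwartzMap.fourierInv_coe, Real.fourierInv_eq', schrodingerFlow]
  congr 1 with ξ
  rw [real_inner_comm, smul_eq_mul, mul_comm]
  congr 2
  push_cast
  ring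

theorem tendsto_schrodingerFlow_zero {n : ℕ} (f : 𝓢(Rn n, ℂ)) (x : Rn n) :
    Tendsto (fun t => schrodingerFlow f t x) (𝓝[>] 0) (𝓝 (f x)) := by
  rw [← schrodingerFlow_zero f x]
  refine tendsto_integral_filter_of_dominated_convergence (fun ξ => ‖𝓕 f ξ‖) ?_ ?_
    (𝓕 f).integrable.norm ?_
  · refine Eventually.of_forall fun ε => Continuous.aestronglyMeasurable ?_
    have := (𝓕 f).continuous
    fun_prop
  · refine Eventually.of_forall fun t => Eventually.of_forall fun ξ => ?_
    rw [norm_mul, Complex.norm_exp_I_mul_ofReal, mul_one]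
  · refine Eventually.of_forall fun ξ => ?_
    have hc : Continuous fun t : ℝ => 𝓕 f ξ * Complex.exp (Complex.I *
      ((2 * Real.pi * ⟪x, ξ⟫ - 4 * Real.pi ^ 2 * t * ‖ξ‖ ^ 2 : ℝ) : ℂ)) := by fun_prop
    exact (hc.tendsto 0).mono_left nhdsWithin_le_nhds

/-- The constant `conj ((4πi)^{-n/2}) (4π)^n` relating `û₀` under the pseudoconformal transform. -/
def pseudoconformalConst (n : ℕ) : ℂ :=
  conj ((Real.pi / (4 * Real.pi ^ 2 * Complex.I)) ^ ((n : ℂ) / 2)) * (4 * Real.pi) ^ n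

/-- This is the Jacobian of ξ ↦ 4πξ, which makes the passage to the transformed data an L² isometry.
-/
theorem norm_pseudoconformalConst_sq (n : ℕ) :
    ‖pseudoconformalConst n‖ ^ 2 = (4 * Real.pi) ^ n := by
  have hpi := Real.pi_pos
  have h1 : ‖(Real.pi / (4 * Real.pi ^ 2 * Complex.I) : ℂ)‖ = (4 * Real.pi)⁻¹ := by
    simp only [norm_div, norm_mul, norm_pow, Complex.norm_I, Complex.norm_real, Real.norm_eq_abs,
      abs_of_pos hpi, mul_one, Complex.norm_ofNat]
    field_simp
  have h2 : ((n : ℂ) / 2) = ((n / 2 : ℝ) : ℂ) := by push_cast; rfl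
  have h3 : (0 : ℝ) ≤ (4 * Real.pi)⁻¹ := by positivity
  have h4 : ‖(4 * Real.pi : ℂ)‖ = 4 * Real.pi := by
    simp [abs_of_pos hpi]
  rw [pseudoconformalConst, norm_mul, RCLike.norm_conj, h2, Complex.norm_cpow_real, h1, mul_pow,
    norm_pow, h4, ← Real.rpow_natCast, ← Real.rpow_mul h3]
  have : (n : ℝ) / 2 * (2 : ℕ) = n := by push_cast; ring
  rw [this, Real.rpow_natCast, inv_pow]
  field_simp

/-- Dilation by `4π` as a continuous linear equivalence. -/
def dilationFourPi (n : ℕ) : Rn n ≃L[ℝ] Rn n :=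
  ContinuousLinearEquiv.smulLeft (Units.mk0 (4 * Real.pi) (by positivity : (4 * Real.pi : ℝ) ≠ 0))

@[simp] theorem dilationFourPi_apply (n : ℕ) (x : Rn n) :
    dilationFourPi n x = (4 * Real.pi) • x := rfl

/-- The initial data of the pseudoconformal transform of `e^{itΔ} f`. -/
def pseudoconformalData {n : ℕ} (f : 𝓢(Rn n, ℂ)) : 𝓢(Rn n, ℂ) :=
  𝓕⁻ (pseudoconformalConst n • SchwartzMap.postcompCLM (𝕜 := ℝ) (Complex.conjCLE : ℂ →L[ℝ] ℂ)
    (SchwartzMap.compCLMOfContinuousLinearEquiv ℝ (dilationFourPi n) f))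

theorem fourier_pseudoconformalData {n : ℕ} (f : 𝓢(Rn n, ℂ)) (ξ : Rn n) :
    𝓕 (pseudoconformalData f) ξ = pseudoconformalConst n * conj (f ((4 * Real.pi) • ξ)) := by
  rw [pseudoconformalData, FourierTransform.fourier_fourierInv_eq]
  simp

/-- In the Fresnel integral at time 1/t, expand t|x/t - z|²/4 = |x|²/(4t) - x·z/2 + t|z|²/4. After
conjugation the first term cancels the factor e^{i|x|²/(4t)}; the other two form the phase of the
free flow in the variable z = 4πξ. -/
theorem pseudoconformal_eq_schrodingerFlow {n : ℕ} (f : 𝓢(Rn n, ℂ)) {t : ℝ} (ht : 0 < t)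
    (x : Rn n) :
    pseudoconformal (schrodingerFlow f) t x = schrodingerFlow (pseudoconformalData f) t x := by
  have hpi := Real.pi_pos
  have htC : (t : ℂ) ≠ 0 := by exact_mod_cast ht.ne'
  have hpC : (Real.pi : ℂ) ≠ 0 := by exact_mod_cast hpi.ne'
  -- the phases agree after the substitution `z = 4πξ`
  have hR : schrodingerFlow (pseudoconformalData f) t x =
      conj ((Real.pi / (4 * Real.pi ^ 2 * Complex.I)) ^ ((n : ℂ) / 2)) *
      ∫ z : Rn n, conj (f z) *
        Complex.exp (Complex.I * ((⟪x, z⟫ / 2 - t * ‖z‖ ^ 2 / 4 : ℝ) : ℂ)) := by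
    have := Measure.integral_comp_smul volume (fun z : Rn n => conj (f z) *
        Complex.exp (Complex.I * ((⟪x, z⟫ / 2 - t * ‖z‖ ^ 2 / 4 : ℝ) : ℂ))) (4 * Real.pi)
    rw [finrank_euclideanSpace_fin, abs_of_pos (by positivity)] at this
    have h4 : ∫ z : Rn n, conj (f z) *
        Complex.exp (Complex.I * ((⟪x, z⟫ / 2 - t * ‖z‖ ^ 2 / 4 : ℝ) : ℂ)) =
        (4 * Real.pi) ^ n • ∫ ξ : Rn n, conj (f ((4 * Real.pi) • ξ)) *
        Complex.exp (Complex.I * ((⟪x, (4 * Real.pi) • ξ⟫ / 2 -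
          t * ‖(4 * Real.pi) • ξ‖ ^ 2 / 4 : ℝ) : ℂ)) := by
      rw [this, smul_smul, mul_inv_cancel₀ (by positivity), one_smul]
    rw [h4, schrodingerFlow, Complex.real_smul, ← mul_assoc, ← integral_const_mul]
    congr 1 with ξ
    rw [fourier_pseudoconformalData, pseudoconformalConst, inner_smul_right, norm_smul,
      Real.norm_eq_abs, abs_of_pos (by positivity : 0 < 4 * Real.pi)]
    push_cast
    rw [mul_assoc]
    congr 4
    ring
  rw [hR, pseudoconformal, schrodingerFlow_eq_integral f (one_div_pos.mpr ht)]
  have hb : (Real.pi / (4 * Real.pi ^ 2 * (1 / t : ℝ) * Complex.I) : ℂ) =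
      (t : ℂ) * (Real.pi / (4 * Real.pi ^ 2 * Complex.I)) := by
    push_cast
    field_simp
  -- A positive real factor splits off a principal power; the resulting t^{n/2} cancels the weight
  -- of the transform.
  have hc : (Real.pi / (4 * Real.pi ^ 2 * (1 / t : ℝ) * Complex.I) : ℂ) ^ ((n : ℂ) / 2) =
      ((t ^ ((n : ℝ) / 2) : ℝ) : ℂ) * (Real.pi / (4 * Real.pi ^ 2 * Complex.I)) ^ ((n : ℂ) / 2) := by
    have hne : (Real.pi / (4 * Real.pi ^ 2 * Complex.I) : ℂ) ≠ 0 := by simp [hpC]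
    rw [hb, Complex.cpow_def_of_ne_zero (mul_ne_zero htC hne), Complex.log_ofReal_mul ht hne,
      Complex.cpow_def_of_ne_zero hne, Real.rpow_def_of_pos ht, Complex.ofReal_exp,
      ← Complex.exp_add]
    congr 1
    push_cast
    ring
  have htp : ((t ^ ((n : ℝ) / 2) : ℝ) : ℂ) ≠ 0 := by
    exact_mod_cast (Real.rpow_pos_of_pos ht _).ne'
  rw [hc, map_mul, map_mul, Complex.conj_ofReal, ← integral_conj]
  have hint : ∫ z : Rn n, conj (f z *
      Complex.exp (Complex.I * ((‖t⁻¹ • x - z‖ ^ 2 / (4 * (1 / t)) : ℝ) : ℂ))) =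
      Complex.exp (-(Complex.I * ((‖x‖ ^ 2 / (4 * t) : ℝ) : ℂ))) * ∫ z : Rn n, conj (f z) *
        Complex.exp (Complex.I * ((⟪x, z⟫ / 2 - t * ‖z‖ ^ 2 / 4 : ℝ) : ℂ)) := by
    rw [← integral_const_mul]
    congr 1 with z
    rw [map_mul, ← Complex.exp_conj, map_mul, Complex.conj_I, Complex.conj_ofReal, mul_left_comm,
      ← Complex.exp_add]
    congr 2
    rw [@norm_sub_sq_real, norm_smul, inner_smul_left, Real.norm_eq_abs,
      abs_of_pos (inv_pos.mpr ht)]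
    simp only [conj_trivial]
    push_cast
    field_simp
    ring
  rw [hint]
  push_cast
  rw [Complex.exp_neg]
  have := Complex.exp_ne_zero (Complex.I * (↑‖x‖ ^ 2 / (4 * ↑t)))
  field_simp

theorem hasInitialData_pseudoconformal {n : ℕ} (f : 𝓢(Rn n, ℂ)) :
    HasInitialData (pseudoconformal (schrodingerFlow f)) (pseudoconformalData f) where
  flow _ ht x := pseudoconformal_eq_schrodingerFlow f ht x
  limit x := by
    refine (tendsto_schrodingerFlow_zero (pseudoconformalData f) x).congr' ?_
    filter_upwards [self_mem_nhdsWithin] with t ht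
    exact (pseudoconformal_eq_schrodingerFlow f ht x).symm

theorem integral_norm_sq_pseudoconformalData {n : ℕ} (f : 𝓢(Rn n, ℂ)) :
    ∫ x, ‖pseudoconformalData f x‖ ^ 2 = ∫ x, ‖f x‖ ^ 2 := by
  rw [← SchwartzMap.integral_norm_sq_fourier]
  simp only [fourier_pseudoconformalData, norm_mul, RCLike.norm_conj, mul_pow,
    norm_pseudoconformalConst_sq]
  rw [integral_const_mul, Measure.integral_comp_smul volume (fun x : Rn n => ‖f x‖ ^ 2),
    finrank_euclideanSpace_fin, abs_of_pos (by positivity), smul_eq_mul, ← mul_assoc, ← mul_pow,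
    mul_inv_cancel₀ (by positivity), one_mul]

theorem eLpNorm_two_eq_sqrt {n : ℕ} (f : 𝓢(Rn n, ℂ)) :
    eLpNorm f 2 volume = ENNReal.ofReal √(∫ x, ‖f x‖ ^ 2) := by
  rw [(f.memLp 2 volume).eLpNorm_eq_integral_rpow_norm (by norm_num) (by norm_num),
    Real.sqrt_eq_rpow]
  norm_num

theorem eLpNorm_pseudoconformalData {n : ℕ} (f : 𝓢(Rn n, ℂ)) :
    eLpNorm (pseudoconformalData f) 2 volume = eLpNorm f 2 volume := by
  rw [eLpNorm_two_eq_sqrt, eLpNorm_two_eq_sqrt, integral_norm_sq_pseudoconformalData]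

theorem tsupport_fourier_pseudoconformalData {n : ℕ} (f : 𝓢(Rn n, ℂ)) :
    tsupport (𝓕 (pseudoconformalData f) : 𝓢(Rn n, ℂ)) ⊆
      (1 / (4 * Real.pi) : ℝ) • tsupport f := by
  have h0 : (1 / (4 * Real.pi) : ℝ) ≠ 0 := by positivity
  refine closure_minimal ?_ ((isClosed_tsupport f).smul₀ _)
  intro ξ hξ
  rw [Function.mem_support, fourier_pseudoconformalData] at hξ
  rw [mem_smul_set_iff_inv_smul_mem₀ h0]
  apply subset_tsupport
  rw [Function.mem_support, one_div, inv_inv]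
  intro h
  simp [h] at hξ

/-! ### Lattice data, their flow, and admissible radii -/

/-- The frequencies `Ω` as a finite set. -/
def freqFinset (n : ℕ) (σ ε₁ R : ℝ) (hR : 0 < R) : Finset (Rn n) :=
  (freqSet_finite n σ ε₁ R hR).toFinset

theorem mem_freqFinset {n : ℕ} {σ ε₁ R : ℝ} {hR : 0 < R} {ξ : Rn n} :
    ξ ∈ freqFinset n σ ε₁ R hR ↔ ξ ∈ freqSet n σ ε₁ R := by
  simp [freqFinset]

theorem norm_lt_of_mem_freqFinset {n : ℕ} {σ ε₁ R : ℝ} {hR : 0 < R} {ξ : Rn n}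
    (h : ξ ∈ freqFinset n σ ε₁ R hR) : ‖ξ‖ < ε₁ * R := by
  have := (mem_freqFinset.mp h).2
  rwa [mem_ball_zero_iff] at this

theorem fourier_latticeData {n : ℕ} (θ : 𝓢(Rn n, ℂ)) (σ ε₁ : ℝ) {R : ℝ} (hR : 0 < R) (ξ : Rn n) :
    𝓕 (latticeData θ σ ε₁ R) ξ = ∑ ξ' ∈ freqFinset n σ ε₁ R hR, θ (ξ - ξ') := by
  rw [latticeData, FourierTransform.fourier_fourierInv_eq,
    finsum_mem_eq_finite_toFinset_sum _ (freqSet_finite n σ ε₁ R hR), _root_.sum_apply]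
  rfl

/-- Galilean invariance: translating the frequency variable by ξ' produces a plane wave times the
flow of the untranslated profile, carried along with velocity 4πξ'. -/
theorem schrodingerFlow_latticeData {n : ℕ} (θ : 𝓢(Rn n, ℂ)) (σ ε₁ : ℝ) {R : ℝ} (hR : 0 < R)
    (s : ℝ) (y : Rn n) :
    schrodingerFlow (latticeData θ σ ε₁ R) s y = ∑ ξ' ∈ freqFinset n σ ε₁ R hR,
      Complex.exp (Complex.I * ((2 * Real.pi * ⟪y, ξ'⟫ - 4 * Real.pi ^ 2 * s * ‖ξ'‖ ^ 2 : ℝ) : ℂ)) *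
      ∫ ξ : Rn n, Complex.exp (Complex.I * ((2 * Real.pi * ⟪y - (4 * Real.pi * s) • ξ', ξ⟫ -
        4 * Real.pi ^ 2 * s * ‖ξ‖ ^ 2 : ℝ) : ℂ)) * θ ξ := by
  rw [schrodingerFlow]
  simp only [fourier_latticeData θ σ ε₁ hR, Finset.sum_mul]
  rw [integral_finsetSum]
  · refine Finset.sum_congr rfl fun ξ' _ => ?_
    rw [← integral_const_mul, ← integral_add_right_eq_self _ ξ']
    congr 1 with ξ
    rw [add_sub_cancel_right, ← mul_assoc, ← Complex.exp_add, mul_comm]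
    congr 2
    rw [@norm_add_sq_real, inner_add_right, inner_sub_left, inner_smul_left, real_inner_comm ξ ξ']
    simp only [conj_trivial]
    push_cast
    ring
  · intro ξ' _
    have h := (SchwartzMap.compSubConstCLM ℂ ξ' θ).integrable (μ := volume)
    refine h.norm.mono' (Continuous.aestronglyMeasurable ?_) (Eventually.of_forall fun ξ => ?_)
    · have := θ.continuous
      fun_prop
    · rw [norm_mul, Complex.norm_exp_I_mul_ofReal, mul_one]
      rfl

theorem latticeData_apply {n : ℕ} (θ : 𝓢(Rn n, ℂ)) (σ ε₁ : ℝ) {R : ℝ} (hR : 0 < R) (x : Rn n) :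
    latticeData θ σ ε₁ R x = (∑ ξ' ∈ freqFinset n σ ε₁ R hR,
      Complex.exp (Complex.I * ((2 * Real.pi * ⟪x, ξ'⟫ : ℝ) : ℂ))) * 𝓕 θ (-x) := by
  rw [← schrodingerFlow_zero, schrodingerFlow_latticeData θ σ ε₁ hR, Finset.sum_mul]
  refine Finset.sum_congr rfl fun ξ' _ => ?_
  rw [SchwartzMap.fourier_coe, Real.fourier_eq']
  simp only [mul_zero, zero_mul, sub_zero, zero_smul]
  congr 2 with ξ
  rw [real_inner_comm, smul_eq_mul, inner_neg_right]
  congr 2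
  push_cast
  ring

theorem annulus_neg {n : ℕ} {a b : ℝ} {x : Rn n} : -x ∈ annulus n a b ↔ x ∈ annulus n a b := by
  simp [annulus]

theorem tsupport_latticeData_subset {n : ℕ} {θ : 𝓢(Rn n, ℂ)} (hθ : IsProfile θ) (σ ε₁ : ℝ) {R : ℝ}
    (hR : 0 < R) :
    tsupport (latticeData θ σ ε₁ R) ⊆ annulus n (1 / 4 ^ (n + 3)) (4 * √(n : ℝ)) := by
  have h : tsupport (latticeData θ σ ε₁ R) ⊆ -tsupport (𝓕 θ : 𝓢(Rn n, ℂ)) := by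
    refine closure_minimal ?_ (isClosed_tsupport _).neg
    intro x hx
    rw [Function.mem_support, latticeData_apply θ σ ε₁ hR] at hx
    exact subset_tsupport _ (right_ne_zero_of_mul hx)
  intro x hx
  exact annulus_neg.mp (hθ.support (h hx))

theorem smul_tsupport_latticeData_subset {n : ℕ} {θ : 𝓢(Rn n, ℂ)} (hθ : IsProfile θ) (σ ε₁ : ℝ)
    {R : ℝ} (hR : 0 < R) :
    (1 / (4 * Real.pi) : ℝ) • tsupport (latticeData θ σ ε₁ R) ⊆
      annulus n (1 / (4 ^ (n + 4) * Real.pi)) (√(n : ℝ) / Real.pi) := by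
  have hpi := Real.pi_pos
  rintro _ ⟨x, hx, rfl⟩
  obtain ⟨h1, h2⟩ := tsupport_latticeData_subset hθ σ ε₁ hR hx
  simp only [annulus, mem_ofPred_eq, norm_smul, Real.norm_eq_abs]
  rw [abs_of_pos (by positivity : 0 < 1 / (4 * Real.pi))]
  have hc : 0 < 1 / (4 * Real.pi) := by positivity
  constructor
  · calc (1 / (4 ^ (n + 4) * Real.pi) : ℝ) = 1 / (4 * Real.pi) * (1 / 4 ^ (n + 3)) := by
          field_simp; ring
      _ < _ := by gcongr
  · calc 1 / (4 * Real.pi) * ‖x‖ < 1 / (4 * Real.pi) * (4 * √(n : ℝ)) := by gcongr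
      _ = _ := by field_simp

/-- On the annulus, 1 = 𝓕 θ (-x) is the same integral without the terms in t. The difference is
controlled by the first two absolute moments A, B of θ, being at most 4πε₁A + 2πB/R. -/
theorem exists_isAdmissible {n : ℕ} {θ : 𝓢(Rn n, ℂ)} (hθ : IsProfile θ) :
    ∃ ε₁ : ℝ, IsAdmissible θ ε₁ := by
  have hpi := Real.pi_pos
  have hi1 : Integrable (fun ξ : Rn n => ‖ξ‖ * ‖θ ξ‖) volume := by
    simpa using θ.integrable_pow_mul volume 1
  have hi2 : Integrable (fun ξ : Rn n => ‖ξ‖ ^ 2 * ‖θ ξ‖) volume := θ.integrable_pow_mul volume 2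
  set A := ∫ ξ : Rn n, ‖ξ‖ * ‖θ ξ‖ with hA
  set B := ∫ ξ : Rn n, ‖ξ‖ ^ 2 * ‖θ ξ‖ with hB
  have hA0 : 0 ≤ A := integral_nonneg fun ξ => by positivity
  have hB0 : 0 ≤ B := integral_nonneg fun ξ => by positivity
  -- This radius and the threshold R > 8π(B + 1) leave at most 1/4 for each moment term; the added
  -- 1's avoid a case distinction at zero.
  refine ⟨1 / (16 * Real.pi * (A + 1)), by positivity, ?_⟩
  filter_upwards [eventually_gt_atTop (8 * Real.pi * (B + 1))] with R hR x hx t ht ξ' hξ'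
  have hR0 : 0 < R := lt_trans (by positivity) hR
  have hone : (1 : ℂ) = ∫ ξ : Rn n,
      Complex.exp (Complex.I * ((2 * Real.pi * ⟪x, ξ⟫ : ℝ) : ℂ)) * θ ξ := by
    rw [← hθ.eq_one (-x) (annulus_neg.mpr hx), SchwartzMap.fourier_coe, Real.fourier_eq']
    congr 1 with ξ
    rw [real_inner_comm, smul_eq_mul, inner_neg_left]
    congr 2
    push_cast
    ring
  have hθc := θ.continuous
  have hint : ∀ φ : Rn n → ℝ, Continuous φ →
      Integrable (fun ξ => Complex.exp (Complex.I * (φ ξ : ℂ)) * θ ξ) volume := by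
    intro φ hφ
    refine (θ.integrable (μ := volume)).norm.mono' (Continuous.aestronglyMeasurable ?_)
      (Eventually.of_forall fun ξ => ?_)
    · fun_prop
    · rw [norm_mul, Complex.norm_exp_I_mul_ofReal, one_mul]
  conv_lhs => rw [hone]
  rw [← integral_sub (hint _ (by fun_prop)) (hint _ (by fun_prop))]
  have hbound : ∀ ξ : Rn n, ‖Complex.exp (Complex.I *
      ((2 * Real.pi * (⟪x - (2 * t / R) • ξ', ξ⟫ - t / R * ‖ξ‖ ^ 2) : ℝ) : ℂ)) * θ ξ -
      Complex.exp (Complex.I * ((2 * Real.pi * ⟪x, ξ⟫ : ℝ) : ℂ)) * θ ξ‖ ≤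
      4 * Real.pi * (1 / (16 * Real.pi * (A + 1))) * (‖ξ‖ * ‖θ ξ‖) +
        2 * Real.pi / R * (‖ξ‖ ^ 2 * ‖θ ξ‖) := by
    intro ξ
    have h1 : Complex.exp (Complex.I *
      ((2 * Real.pi * (⟪x - (2 * t / R) • ξ', ξ⟫ - t / R * ‖ξ‖ ^ 2) : ℝ) : ℂ)) * θ ξ -
      Complex.exp (Complex.I * ((2 * Real.pi * ⟪x, ξ⟫ : ℝ) : ℂ)) * θ ξ =
      Complex.exp (Complex.I * ((2 * Real.pi * ⟪x, ξ⟫ : ℝ) : ℂ)) *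
      (Complex.exp (Complex.I * ((-(2 * Real.pi * (2 * t / R * ⟪ξ', ξ⟫ + t / R * ‖ξ‖ ^ 2)) : ℝ) : ℂ))
        - 1) * θ ξ := by
      rw [mul_sub (Complex.exp _), ← Complex.exp_add, sub_mul, mul_one]
      congr 3
      rw [inner_sub_left, inner_smul_left]
      simp only [conj_trivial]
      push_cast
      ring
    rw [h1, norm_mul, norm_mul, Complex.norm_exp_I_mul_ofReal, one_mul]
    have h2 := Real.norm_exp_I_mul_ofReal_sub_one_le
      (x := -(2 * Real.pi * (2 * t / R * ⟪ξ', ξ⟫ + t / R * ‖ξ‖ ^ 2)))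
    have h3 : ‖-(2 * Real.pi * (2 * t / R * ⟪ξ', ξ⟫ + t / R * ‖ξ‖ ^ 2))‖ ≤
      4 * Real.pi * (1 / (16 * Real.pi * (A + 1))) * ‖ξ‖ + 2 * Real.pi / R * ‖ξ‖ ^ 2 := by
      have ht0 := ht.1
      have h4 : |⟪ξ', ξ⟫| ≤ 1 / (16 * Real.pi * (A + 1)) * R * ‖ξ‖ :=
        (abs_real_inner_le_norm ξ' ξ).trans (by gcongr)
      rw [norm_neg, Real.norm_eq_abs, abs_mul, abs_of_pos (by positivity : 0 < 2 * Real.pi)]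
      calc 2 * Real.pi * |2 * t / R * ⟪ξ', ξ⟫ + t / R * ‖ξ‖ ^ 2|
          ≤ 2 * Real.pi * (2 * t / R * |⟪ξ', ξ⟫| + t / R * ‖ξ‖ ^ 2) := by
            gcongr
            refine (abs_add_le _ _).trans_eq ?_
            rw [abs_mul, abs_of_pos (by positivity : 0 < 2 * t / R),
              abs_of_nonneg (by positivity : 0 ≤ t / R * ‖ξ‖ ^ 2)]
        _ ≤ 2 * Real.pi * (2 * 1 / R * (1 / (16 * Real.pi * (A + 1)) * R * ‖ξ‖) +
            1 / R * ‖ξ‖ ^ 2) := by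
            have := ht.2.le
            gcongr
        _ = _ := by field_simp; ring
    calc _ ≤ (4 * Real.pi * (1 / (16 * Real.pi * (A + 1))) * ‖ξ‖ + 2 * Real.pi / R * ‖ξ‖ ^ 2) *
          ‖θ ξ‖ := by gcongr; exact h2.trans h3
      _ = _ := by ring
  calc _ ≤ ∫ ξ : Rn n, (4 * Real.pi * (1 / (16 * Real.pi * (A + 1))) * (‖ξ‖ * ‖θ ξ‖) +
        2 * Real.pi / R * (‖ξ‖ ^ 2 * ‖θ ξ‖)) :=
        norm_integral_le_of_norm_le ((hi1.const_mul _).add (hi2.const_mul _))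
          (Eventually.of_forall hbound)
    _ = 4 * Real.pi * (1 / (16 * Real.pi * (A + 1))) * A + 2 * Real.pi / R * B := by
        rw [integral_add (hi1.const_mul _) (hi2.const_mul _), integral_const_mul,
          integral_const_mul]
    _ < 1 / 2 := by
        have e1 : 4 * Real.pi * (1 / (16 * Real.pi * (A + 1))) * A ≤ 1 / 4 := by
          rw [mul_one_div, div_mul_eq_mul_div, div_le_div_iff₀ (by positivity) (by norm_num)]
          nlinarith
        have e2 : 2 * Real.pi / R * B < 1 / 4 := by
          rw [div_mul_eq_mul_div, div_lt_div_iff₀ hR0 (by norm_num)]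
          nlinarith
        linarith

/-! ### Orthogonality over cubes, counting frequencies, and the L² norm of the data -/

/-- The cube `(p, p + L]ⁿ`. -/
def cube (n : ℕ) (p L : ℝ) : Set (Rn n) :=
  WithLp.ofLp ⁻¹' (univ.pi fun _ : Fin n => Ioc p (p + L))

theorem mem_cube {n : ℕ} {p L : ℝ} {x : Rn n} : x ∈ cube n p L ↔ ∀ i, p < x i ∧ x i ≤ p + L := by
  simp [cube]

theorem measurableSet_cube (n : ℕ) (p L : ℝ) : MeasurableSet (cube n p L) :=
  (MeasurableSet.univ_pi fun _ => measurableSet_Ioc).preimage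
    (PiLp.volume_preserving_ofLp (Fin n)).measurable

theorem volume_cube (n : ℕ) (p : ℝ) (L : ℝ) : volume (cube n p L) = ENNReal.ofReal L ^ n := by
  rw [cube, (PiLp.volume_preserving_ofLp (Fin n)).measure_preimage
    (MeasurableSet.univ_pi fun _ => measurableSet_Ioc).nullMeasurableSet, Real.volume_pi_Ioc]
  simp

theorem setIntegral_cube_prod {n : ℕ} (p L : ℝ) (g : Fin n → ℝ → ℂ) :
    ∫ x in cube n p L, ∏ i, g i (x i) = ∏ i, ∫ x in Ioc p (p + L), g i x := by
  have h := (PiLp.volume_preserving_ofLp (Fin n)).setIntegral_preimage_emb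
    (MeasurableEquiv.toLp 2 (Fin n → ℝ)).symm.measurableEmbedding (fun y => ∏ i, g i (y i))
    (univ.pi fun _ : Fin n => Ioc p (p + L))
  rw [cube]
  refine Eq.trans h ?_
  rw [volume_pi, Measure.restrict_pi_pi, integral_fintype_prod_eq_prod]

theorem setIntegral_Ioc_exp {p q L : ℝ} (hq : 0 < q) (hL : 0 < L) {l : ℕ} (hl : q * L = l) (d : ℤ) :
    ∫ x in Ioc p (p + L), Complex.exp (Complex.I * ((2 * Real.pi * (q * d * x) : ℝ) : ℂ)) =
      if d = 0 then (L : ℂ) else 0 := by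
  rw [← intervalIntegral.integral_of_le (by linarith)]
  split_ifs with hd
  · simp [hd]
  · have hc : (2 * Real.pi * q * d * Complex.I : ℂ) ≠ 0 := by
      simp [Real.pi_ne_zero, hq.ne', hd]
    have h1 : ∀ x : ℝ, Complex.exp (Complex.I * ((2 * Real.pi * (q * d * x) : ℝ) : ℂ)) =
        Complex.exp ((2 * Real.pi * q * d * Complex.I : ℂ) * x) := by
      intro x; congr 1; push_cast; ring
    simp only [h1]
    rw [integral_exp_mul_complex hc]
    have h2 : (2 * Real.pi * q * d * Complex.I : ℂ) * ((p + L : ℝ) : ℂ) =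
        (2 * Real.pi * q * d * Complex.I : ℂ) * p + ((d * l : ℤ) : ℂ) * (2 * Real.pi * Complex.I) := by
      have : (q : ℂ) * L = l := by exact_mod_cast hl
      push_cast
      linear_combination (2 * Real.pi * d * Complex.I : ℂ) * this
    rw [h2, Complex.exp_add, Complex.exp_int_mul_two_pi_mul_I]
    simp

theorem setIntegral_cube_exp {n : ℕ} {p q L : ℝ} (hq : 0 < q) (hL : 0 < L) {l : ℕ}
    (hl : q * L = l) (k : Fin n → ℤ) :
    ∫ x in cube n p L, Complex.exp (Complex.I *
      ((2 * Real.pi * ⟪x, WithLp.toLp 2 fun i => q * (k i : ℝ)⟫ : ℝ) : ℂ)) =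
      if k = 0 then (L : ℂ) ^ n else 0 := by
  have h1 : ∀ x : Rn n, Complex.exp (Complex.I *
      ((2 * Real.pi * ⟪x, WithLp.toLp 2 fun i => q * (k i : ℝ)⟫ : ℝ) : ℂ)) =
      ∏ i, Complex.exp (Complex.I * ((2 * Real.pi * (q * k i * x i) : ℝ) : ℂ)) := by
    intro x
    rw [← Complex.exp_sum, PiLp.inner_apply]
    congr 1
    rw [Finset.mul_sum, Complex.ofReal_sum, Finset.mul_sum]
    simp
  simp only [h1]
  rw [setIntegral_cube_prod p L
    (fun i x => Complex.exp (Complex.I * ((2 * Real.pi * (q * k i * x) : ℝ) : ℂ)))]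
  simp only [setIntegral_Ioc_exp hq hL hl]
  split_ifs with hk
  · simp [hk]
  · obtain ⟨i, hi⟩ := Function.ne_iff.mp hk
    exact Finset.prod_eq_zero (Finset.mem_univ i) (if_neg hi)

/-- Orthogonality of the exponentials with frequencies in `q ℤⁿ` over a cube whose side is a
multiple of the period `1 / q`. -/
theorem setIntegral_cube_norm_sq_sum_exp {n : ℕ} {p q L : ℝ} (hq : 0 < q) (hL : 0 < L) {l : ℕ}
    (hl : q * L = l) (F : Finset (Rn n))
    (hF : ∀ ξ ∈ F, ∃ k : Fin n → ℤ, ξ = WithLp.toLp 2 fun i => q * (k i : ℝ)) :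
    ∫ x in cube n p L, ‖∑ ξ ∈ F, Complex.exp (Complex.I * ((2 * Real.pi * ⟪x, ξ⟫ : ℝ) : ℂ))‖ ^ 2 =
      F.card * L ^ n := by
  have hfin : volume (cube n p L) ≠ ∞ := by rw [volume_cube]; finiteness
  have : IsFiniteMeasure (volume.restrict (cube n p L)) := isFiniteMeasure_restrict.mpr hfin
  rw [← Complex.ofReal_inj, ← integral_complex_ofReal]
  have h1 : ∀ x : Rn n, (((‖∑ ξ ∈ F, Complex.exp (Complex.I *
      ((2 * Real.pi * ⟪x, ξ⟫ : ℝ) : ℂ))‖ ^ 2 : ℝ)) : ℂ) =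
      ∑ ξ ∈ F, ∑ η ∈ F, Complex.exp (Complex.I * ((2 * Real.pi * ⟪x, ξ - η⟫ : ℝ) : ℂ)) := by
    intro x
    rw [Complex.ofReal_pow, ← Complex.mul_conj', map_sum, Finset.sum_mul_sum]
    refine Finset.sum_congr rfl fun ξ _ => Finset.sum_congr rfl fun η _ => ?_
    rw [← Complex.exp_conj, ← Complex.exp_add, map_mul, Complex.conj_I, Complex.conj_ofReal,
      inner_sub_right]
    congr 1
    push_cast
    ring
  simp only [h1]
  have hint : ∀ ξ : Rn n, Integrable (fun x : Rn n =>
      Complex.exp (Complex.I * ((2 * Real.pi * ⟪x, ξ⟫ : ℝ) : ℂ))) (volume.restrict (cube n p L)) := by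
    intro ξ
    refine Integrable.of_bound (C := 1) (Continuous.aestronglyMeasurable (by fun_prop))
      (Eventually.of_forall fun x => ?_)
    rw [Complex.norm_exp_I_mul_ofReal]
  rw [integral_finsetSum _ fun ξ _ => integrable_finsetSum _ fun η _ => hint _]
  have h2 : ∀ ξ ∈ F, ∫ x in cube n p L, ∑ η ∈ F,
      Complex.exp (Complex.I * ((2 * Real.pi * ⟪x, ξ - η⟫ : ℝ) : ℂ)) = (L : ℂ) ^ n := by
    intro ξ hξ
    rw [integral_finsetSum _ fun η _ => hint _, Finset.sum_eq_single ξ]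
    · have := setIntegral_cube_exp (n := n) (p := p) hq hL hl 0
      rw [if_pos rfl] at this
      rw [← this, sub_self]
      have h0 : (0 : Rn n) = WithLp.toLp 2 fun i => q * (((0 : Fin n → ℤ) i : ℤ) : ℝ) := by
        ext i; simp
      rw [← h0]
    · intro η hη hne
      obtain ⟨k, rfl⟩ := hF ξ hξ
      obtain ⟨m, rfl⟩ := hF η hη
      have h0 : (WithLp.toLp 2 fun i => q * (k i : ℝ) : Rn n) - (WithLp.toLp 2 fun i => q * (m i : ℝ)) =
          WithLp.toLp 2 fun i => q * (((k - m) i : ℤ) : ℝ) := by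
        ext i; simp; ring
      rw [h0, setIntegral_cube_exp hq hL hl, if_neg]
      rintro hkm
      exact hne (by rw [sub_eq_zero.mp hkm])
    · intro h; exact absurd hξ h
  rw [Finset.sum_congr rfl h2]
  simp

theorem exists_of_mem_freqFinset {n : ℕ} {σ ε₁ R : ℝ} {hR : 0 < R} {ξ : Rn n}
    (h : ξ ∈ freqFinset n σ ε₁ R hR) :
    ∃ k : Fin n → ℤ, ξ = WithLp.toLp 2 fun i => R ^ (1 - σ) * (k i : ℝ) :=
  (mem_freqFinset.mp h).1

theorem rpow_one_sub_mul_rpow {R : ℝ} (hR : 0 < R) (σ : ℝ) : R ^ (1 - σ) * R ^ σ = R := by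
  rw [← Real.rpow_add hR]; simp

theorem norm_toLp_smul {n : ℕ} {q : ℝ} (hq : 0 < q) (k : Fin n → ℝ) :
    ‖(WithLp.toLp 2 fun i => q * k i : Rn n)‖ = q * ‖(WithLp.toLp 2 k : Rn n)‖ := by
  have : (WithLp.toLp 2 fun i => q * k i : Rn n) = q • (WithLp.toLp 2 k : Rn n) := by
    ext i; simp
  rw [this, norm_smul, Real.norm_eq_abs, abs_of_pos hq]

theorem norm_le_sqrt_mul {n : ℕ} {x : Rn n} {a : ℝ} (ha : 0 ≤ a) (h : ∀ i, |x i| ≤ a) :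
    ‖x‖ ≤ √(n : ℝ) * a := by
  rw [EuclideanSpace.norm_eq]
  calc √(∑ i, ‖x i‖ ^ 2) ≤ √(∑ _i : Fin n, a ^ 2) := by
        gcongr with i; exact h i
    _ = _ := by simp [Real.sqrt_sq ha]

theorem norm_lt_sqrt_mul {n : ℕ} (hn : 1 ≤ n) {x : Rn n} {a : ℝ} (ha : 0 < a) (h : ∀ i, |x i| < a) :
    ‖x‖ < √(n : ℝ) * a := by
  have hne : (Finset.univ : Finset (Fin n)).Nonempty := ⟨⟨0, hn⟩, Finset.mem_univ _⟩
  rw [EuclideanSpace.norm_eq]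
  calc √(∑ i, ‖x i‖ ^ 2) < √(∑ _i : Fin n, a ^ 2) := by
        refine Real.sqrt_lt_sqrt (Finset.sum_nonneg fun i _ => by positivity) ?_
        refine Finset.sum_lt_sum_of_nonempty hne fun i _ => ?_
        gcongr; exact h i
    _ = _ := by simp [Real.sqrt_sq ha.le]

theorem sqrt_mul_le_norm {n : ℕ} {x : Rn n} {a : ℝ} (ha : 0 ≤ a) (h : ∀ i, a ≤ |x i|) :
    √(n : ℝ) * a ≤ ‖x‖ := by
  rw [EuclideanSpace.norm_eq]
  calc _ = √(∑ _i : Fin n, a ^ 2) := by simp [Real.sqrt_sq ha]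
    _ ≤ √(∑ i, ‖x i‖ ^ 2) := by
        gcongr with i; exact h i

theorem le_card_freqFinset {n : ℕ} (hn : 1 ≤ n) (σ : ℝ) {ε₁ R : ℝ} (hR : 0 < R) (hε : 0 < ε₁) :
    (ε₁ * R ^ σ / √(n : ℝ)) ^ n ≤ (freqFinset n σ ε₁ R hR).card := by
  have hn0 : 0 < √(n : ℝ) := Real.sqrt_pos.mpr (by exact_mod_cast hn)
  have hq : 0 < R ^ (1 - σ) := Real.rpow_pos_of_pos hR _
  have hσ : 0 < R ^ σ := Real.rpow_pos_of_pos hR _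
  set ρ := ε₁ * R ^ σ / √(n : ℝ) with hρ
  have hρ0 : 0 < ρ := by positivity
  -- A natural number is below ⌈ρ⌉₊ exactly when it is below ρ, so this box yields at least ρⁿ
  -- points and still fits in the open ball.
  let f : (Fin n → Fin ⌈ρ⌉₊) → Rn n := fun k => WithLp.toLp 2 fun i => R ^ (1 - σ) * ((k i : ℕ) : ℝ)
  have hinj : Function.Injective f := by
    intro k m hkm
    funext i
    have := congrArg (fun x : Rn n => x i) hkm
    simp only [f] at this
    have h2 := mul_left_cancel₀ hq.ne' this
    exact Fin.ext (by exact_mod_cast h2)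
  have hmem : ∀ k, f k ∈ freqFinset n σ ε₁ R hR := by
    intro k
    refine mem_freqFinset.mpr ⟨⟨fun i => ((k i : ℕ) : ℤ), by simp [f]⟩, ?_⟩
    rw [mem_ball_zero_iff]
    simp only [f]
    rw [norm_toLp_smul hq]
    have : ‖(WithLp.toLp 2 fun i => ((k i : ℕ) : ℝ) : Rn n)‖ < √(n : ℝ) * ρ := by
      refine norm_lt_sqrt_mul hn hρ0 fun i => ?_
      simp only [Nat.abs_cast]
      exact Nat.lt_ceil.mp (k i).2
    calc _ < R ^ (1 - σ) * (√(n : ℝ) * ρ) := by gcongr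
      _ = ε₁ * (R ^ (1 - σ) * R ^ σ) := by rw [hρ]; field_simp
      _ = ε₁ * R := by rw [rpow_one_sub_mul_rpow hR]
  have hcard := Finset.card_le_card_of_injOn (s := (Finset.univ : Finset (Fin n → Fin ⌈ρ⌉₊)))
    (t := freqFinset n σ ε₁ R hR) f (fun k _ => hmem k) hinj.injOn
  simp only [Finset.card_univ, Fintype.card_fun, Fintype.card_fin] at hcard
  calc ρ ^ n ≤ (⌈ρ⌉₊ : ℝ) ^ n := by gcongr; exact Nat.le_ceil ρ
    _ ≤ _ := by exact_mod_cast hcard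

/-- Each coordinate has at most 2⌊ε₁R^σ⌋ + 1 values, and R^σ ≥ 1 absorbs the 1. -/
theorem card_freqFinset_le {n : ℕ} {σ ε₁ R : ℝ} (hR : 0 < R) (hε : 0 < ε₁) (hσ : 1 ≤ R ^ σ) :
    ((freqFinset n σ ε₁ R hR).card : ℝ) ≤ ((2 * ε₁ + 1) * R ^ σ) ^ n := by
  classical
  have hq : 0 < R ^ (1 - σ) := Real.rpow_pos_of_pos hR _
  set M := ⌊ε₁ * R ^ σ⌋₊ with hM
  have hMle : (M : ℝ) ≤ ε₁ * R ^ σ := Nat.floor_le (by positivity)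
  have hsub : freqFinset n σ ε₁ R hR ⊆
      (Fintype.piFinset fun _ : Fin n => Finset.Icc (-(M : ℤ)) M).image
        (fun k => (WithLp.toLp 2 fun i => R ^ (1 - σ) * (k i : ℝ) : Rn n)) := by
    intro ξ hξ
    obtain ⟨k, rfl⟩ := exists_of_mem_freqFinset hξ
    refine Finset.mem_image.mpr ⟨k, ?_, rfl⟩
    rw [Fintype.mem_piFinset]
    intro i
    have h1 := norm_lt_of_mem_freqFinset hξ
    have h2 := (PiLp.norm_apply_le
      (WithLp.toLp 2 fun i => R ^ (1 - σ) * (k i : ℝ) : Rn n) i).trans h1.le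
    simp only [Real.norm_eq_abs, abs_mul, abs_of_pos hq] at h2
    have h3 : |(k i : ℝ)| ≤ ε₁ * R ^ σ := by
      refine le_of_mul_le_mul_left (h2.trans_eq ?_) hq
      conv_lhs => rw [← rpow_one_sub_mul_rpow hR σ]
      ring
    have h4 : (k i).natAbs ≤ M := by
      refine Nat.le_floor ?_
      rwa [Nat.cast_natAbs, Int.cast_abs]
    rw [Finset.mem_Icc]
    omega
  have h1 := (Finset.card_le_card hsub).trans Finset.card_image_le
  rw [Fintype.card_piFinset] at h1
  simp only [Int.card_Icc, Finset.prod_const, Finset.card_univ, Fintype.card_fin] at h1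
  have h2 : ((M : ℤ) + 1 - -(M : ℤ)).toNat = 2 * M + 1 := by omega
  rw [h2] at h1
  calc _ ≤ ((2 * M + 1 : ℕ) : ℝ) ^ n := by exact_mod_cast h1
    _ ≤ _ := by
      gcongr
      push_cast
      linarith

theorem integrableOn_cube_norm_sq_sum_exp {n : ℕ} (p L : ℝ) (F : Finset (Rn n)) :
    IntegrableOn (fun x : Rn n =>
      ‖∑ ξ ∈ F, Complex.exp (Complex.I * ((2 * Real.pi * ⟪x, ξ⟫ : ℝ) : ℂ))‖ ^ 2) (cube n p L) := by
  have hfin : volume (cube n p L) ≠ ∞ := by rw [volume_cube]; finiteness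
  have : IsFiniteMeasure (volume.restrict (cube n p L)) := isFiniteMeasure_restrict.mpr hfin
  refine Integrable.of_bound (C := (F.card : ℝ) ^ 2) (Continuous.aestronglyMeasurable (by fun_prop))
    (Eventually.of_forall fun x => ?_)
  rw [norm_pow, norm_norm]
  gcongr
  refine (norm_sum_le _ _).trans_eq ?_
  simp only [Complex.norm_exp_I_mul_ofReal]
  simp

theorem integrable_norm_sq {n : ℕ} (f : 𝓢(Rn n, ℂ)) : Integrable fun x => ‖f x‖ ^ 2 :=
  (f.memLp 2 volume).integrable_norm_pow (by norm_num)

/-- On a cube where 𝓕 θ (-x) = 1 the data are the bare exponential sum, whose square integral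
orthogonality evaluates exactly. -/
theorem le_integral_norm_sq_latticeData {n : ℕ} (hn : 1 ≤ n) {θ : 𝓢(Rn n, ℂ)} (hθ : IsProfile θ)
    {σ ε₁ R : ℝ} (hR : 0 < R) (hε : 0 < ε₁) (hq : 2 ≤ R ^ (1 - σ)) :
    (ε₁ / (2 * √(n : ℝ))) ^ n * (R ^ σ) ^ n ≤ ∫ x, ‖latticeData θ σ ε₁ R x‖ ^ 2 := by
  have hn0 : 1 ≤ √(n : ℝ) := Real.one_le_sqrt.mpr (by exact_mod_cast hn)
  set q := R ^ (1 - σ) with hqdef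
  have hq0 : 0 < q := by linarith
  set l := ⌊q⌋₊ with hl
  have hl1 : (l : ℝ) ≤ q := Nat.floor_le hq0.le
  have hl2 : q < l + 1 := Nat.lt_floor_add_one q
  -- The largest multiple of 1/q not exceeding 1; q ≥ 2 makes it at least 1/2. The cube then has
  -- coordinates in (1/2, 3/2].
  set L := (l : ℝ) / q with hL
  have hL1 : L ≤ 1 := (div_le_one hq0).mpr hl1
  have hL2 : 1 / 2 ≤ L := by rw [hL, le_div_iff₀ hq0]; linarith
  have hqL : q * L = l := by rw [hL]; field_simp
  have hcube : ∀ x ∈ cube n (1 / 2) L, ‖latticeData θ σ ε₁ R x‖ ^ 2 =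
      ‖∑ ξ ∈ freqFinset n σ ε₁ R hR,
        Complex.exp (Complex.I * ((2 * Real.pi * ⟪x, ξ⟫ : ℝ) : ℂ))‖ ^ 2 := by
    intro x hx
    rw [mem_cube] at hx
    rw [latticeData_apply θ σ ε₁ hR, hθ.eq_one, mul_one]
    refine annulus_neg.mpr ⟨?_, ?_⟩
    · have h1 : √(n : ℝ) * (1 / 2) ≤ ‖x‖ :=
        sqrt_mul_le_norm (by norm_num) fun i => (hx i).1.le.trans (le_abs_self _)
      have h2 : (1 : ℝ) / 4 ^ (n + 2) ≤ 1 / 4 := by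
        gcongr
        calc (4 : ℝ) = 4 ^ 1 := by norm_num
          _ ≤ _ := by gcongr <;> [norm_num; omega]
      linarith
    · have h1 : ‖x‖ ≤ √(n : ℝ) * (3 / 2) := by
        refine norm_le_sqrt_mul (by norm_num) fun i => ?_
        rw [abs_of_pos (by linarith [(hx i).1])]
        linarith [(hx i).2]
      linarith
  calc (ε₁ / (2 * √(n : ℝ))) ^ n * (R ^ σ) ^ n
      = (ε₁ * R ^ σ / √(n : ℝ)) ^ n * (1 / 2) ^ n := by
        rw [← mul_pow, ← mul_pow]; congr 1; field_simp
    _ ≤ (freqFinset n σ ε₁ R hR).card * L ^ n := by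
        gcongr; exact le_card_freqFinset hn σ hR hε
    _ = ∫ x in cube n (1 / 2) L, ‖latticeData θ σ ε₁ R x‖ ^ 2 := by
        rw [setIntegral_congr_fun (measurableSet_cube n _ _) hcube,
          setIntegral_cube_norm_sq_sum_exp hq0 (by linarith) hqL _
            fun ξ hξ => exists_of_mem_freqFinset hξ]
    _ ≤ _ := setIntegral_le_integral (integrable_norm_sq _)
        (Eventually.of_forall fun x => by positivity)

theorem integral_norm_sq_latticeData_le {n : ℕ} {θ : 𝓢(Rn n, ℂ)} (hθ : IsProfile θ)
    {B : ℝ} (hB : ∀ x, ‖𝓕 θ x‖ ≤ B)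
    {σ ε₁ R : ℝ} (hR : 0 < R) (hε : 0 < ε₁) (hq : 1 ≤ R ^ (1 - σ)) (hσ : 1 ≤ R ^ σ) :
    ∫ x, ‖latticeData θ σ ε₁ R x‖ ^ 2 ≤
      (B ^ 2 * (2 * ε₁ + 1) ^ n * (8 * √(n : ℝ) + 1) ^ n) * (R ^ σ) ^ n := by
  set q := R ^ (1 - σ) with hqdef
  have hq0 : 0 < q := by linarith
  -- Rounding upwards makes the side at least 8√n, so the cube contains the support, at the cost of
  -- at most 1 in length.
  set l := ⌊8 * √(n : ℝ) * q⌋₊ + 1 with hl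
  have hl1 : (l : ℝ) ≤ (8 * √(n : ℝ) + 1) * q := by
    have := Nat.floor_le (by positivity : 0 ≤ 8 * √(n : ℝ) * q)
    rw [hl]; push_cast; linarith
  have hl2 : 8 * √(n : ℝ) * q ≤ l := by
    rw [hl]; push_cast; exact (Nat.lt_floor_add_one _).le
  set L := (l : ℝ) / q with hL
  have hL1 : L ≤ 8 * √(n : ℝ) + 1 := (div_le_iff₀ hq0).mpr hl1
  have hL2 : 8 * √(n : ℝ) ≤ L := (le_div_iff₀ hq0).mpr hl2
  have hL0 : 0 < L := div_pos (by rw [hl]; positivity) hq0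
  have hqL : q * L = l := by rw [hL]; field_simp
  have hzero : ∀ x, x ∉ cube n (-(4 * √(n : ℝ))) L → ‖latticeData θ σ ε₁ R x‖ ^ 2 = 0 := by
    intro x hx
    by_contra hne
    refine hx (mem_cube.mpr fun i => ?_)
    have h1 : x ∈ tsupport (latticeData θ σ ε₁ R) := by
      refine subset_tsupport _ ?_
      rw [Function.mem_support]
      rintro h; simp [h] at hne
    have h2 := (tsupport_latticeData_subset hθ σ ε₁ hR h1).2
    have h3 := abs_lt.mp ((PiLp.norm_apply_le x i).trans_lt h2)
    constructor <;> linarith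
  have hle : ∀ x, ‖latticeData θ σ ε₁ R x‖ ^ 2 ≤ B ^ 2 * ‖∑ ξ ∈ freqFinset n σ ε₁ R hR,
        Complex.exp (Complex.I * ((2 * Real.pi * ⟪x, ξ⟫ : ℝ) : ℂ))‖ ^ 2 := by
    intro x
    rw [latticeData_apply θ σ ε₁ hR, norm_mul, mul_pow, mul_comm]
    gcongr
    exact hB _
  calc ∫ x, ‖latticeData θ σ ε₁ R x‖ ^ 2
      = ∫ x in cube n (-(4 * √(n : ℝ))) L, ‖latticeData θ σ ε₁ R x‖ ^ 2 :=
        (setIntegral_eq_integral_of_forall_compl_eq_zero hzero).symm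
    _ ≤ ∫ x in cube n (-(4 * √(n : ℝ))) L, B ^ 2 * ‖∑ ξ ∈ freqFinset n σ ε₁ R hR,
        Complex.exp (Complex.I * ((2 * Real.pi * ⟪x, ξ⟫ : ℝ) : ℂ))‖ ^ 2 :=
        setIntegral_mono (integrable_norm_sq _).integrableOn
          ((integrableOn_cube_norm_sq_sum_exp _ _ _).const_mul _) hle
    _ = B ^ 2 * ((freqFinset n σ ε₁ R hR).card * L ^ n) := by
        rw [integral_const_mul, setIntegral_cube_norm_sq_sum_exp hq0 hL0 hqL _
            fun ξ hξ => exists_of_mem_freqFinset hξ]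
    _ ≤ B ^ 2 * (((2 * ε₁ + 1) * R ^ σ) ^ n * (8 * √(n : ℝ) + 1) ^ n) := by
        gcongr; exact card_freqFinset_le hR hε hσ
    _ = _ := by rw [mul_pow]; ring

theorem rpow_mul_half_eq_sqrt {R : ℝ} (hR : 0 < R) (σ : ℝ) (n : ℕ) :
    R ^ (σ * n / 2) = √((R ^ σ) ^ n) := by
  rw [Real.sqrt_eq_rpow, ← Real.rpow_natCast, ← Real.rpow_mul hR.le, ← Real.rpow_mul hR.le]
  congr 1
  ring

theorem exists_eLpNorm_latticeData_bounds {n : ℕ} (hn : 1 ≤ n) {θ : 𝓢(Rn n, ℂ)} (hθ : IsProfile θ)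
    {σ ε₁ : ℝ} (hσ : σ < 1) (hε : 0 < ε₁) :
    ∃ c C : ℝ, 0 < c ∧ 0 < C ∧ ∀ᶠ R : ℝ in atTop, 1 ≤ R ^ σ →
      ENNReal.ofReal (c * R ^ (σ * n / 2)) ≤ eLpNorm (latticeData θ σ ε₁ R) 2 volume ∧
      eLpNorm (latticeData θ σ ε₁ R) 2 volume ≤ ENNReal.ofReal (C * R ^ (σ * n / 2)) := by
  have hn0 : 0 < √(n : ℝ) := Real.sqrt_pos.mpr (by exact_mod_cast hn)
  set B := SchwartzMap.seminorm ℝ 0 0 (𝓕 θ) with hB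
  have hBle : ∀ x, ‖𝓕 θ x‖ ≤ B := fun x => SchwartzMap.norm_le_seminorm ℝ (𝓕 θ) x
  refine ⟨√((ε₁ / (2 * √(n : ℝ))) ^ n),
    √(B ^ 2 * (2 * ε₁ + 1) ^ n * (8 * √(n : ℝ) + 1) ^ n) + 1, by positivity, by positivity, ?_⟩
  have hq : ∀ᶠ R : ℝ in atTop, 2 ≤ R ^ (1 - σ) :=
    (tendsto_rpow_atTop (by linarith)).eventually_ge_atTop 2
  filter_upwards [hq, eventually_gt_atTop 0] with R hq hR hσR
  rw [eLpNorm_two_eq_sqrt, rpow_mul_half_eq_sqrt hR]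
  constructor
  · rw [← Real.sqrt_mul (by positivity)]
    exact ENNReal.ofReal_le_ofReal (Real.sqrt_le_sqrt (le_integral_norm_sq_latticeData hn hθ hR hε hq))
  · refine ENNReal.ofReal_le_ofReal ?_
    calc _ ≤ √((B ^ 2 * (2 * ε₁ + 1) ^ n * (8 * √(n : ℝ) + 1) ^ n) * (R ^ σ) ^ n) :=
          Real.sqrt_le_sqrt (integral_norm_sq_latticeData_le hθ hBle hR hε (by linarith) hσR)
      _ = √(B ^ 2 * (2 * ε₁ + 1) ^ n * (8 * √(n : ℝ) + 1) ^ n) * √((R ^ σ) ^ n) :=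
          Real.sqrt_mul (by positivity) _
      _ ≤ _ := by gcongr; linarith

/-! ### Diophantine approximation and the measure of the exceptional points -/

/-- Dirichlet's theorem on simultaneous Diophantine approximation. -/
theorem exists_simultaneous_approx {n M : ℕ} (hM : 0 < M) (z : Fin n → ℝ) :
    ∃ j : ℕ, 0 < j ∧ j ≤ M ^ n ∧ ∃ m : Fin n → ℤ, ∀ i, |j * z i - m i| ≤ 1 / M := by
  have hM0 : (0 : ℝ) < M := by exact_mod_cast hM
  have hlt : ∀ a : ℝ, ⌊(M : ℝ) * Int.fract a⌋₊ < M := by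
    intro a
    have h0 := mul_nonneg hM0.le (Int.fract_nonneg a)
    rw [Nat.floor_lt h0]
    have := Int.fract_lt_one a
    nlinarith
  -- Pigeonhole: the multiples az, 0 ≤ a ≤ Mⁿ, fall modulo 1 into Mⁿ boxes of side 1/M, and j is the
  -- difference of two indices sharing a box.
  let f : Fin (M ^ n + 1) → (Fin n → Fin M) := fun a i =>
    ⟨⌊(M : ℝ) * Int.fract ((a : ℕ) * z i)⌋₊, hlt _⟩
  have key : ∃ a b : Fin (M ^ n + 1), a < b ∧ f a = f b := by
    obtain ⟨a, b, hne, hab⟩ := Fintype.exists_ne_map_eq_of_card_lt f (by simp)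
    rcases lt_or_gt_of_ne hne with h | h
    · exact ⟨a, b, h, hab⟩
    · exact ⟨b, a, h, hab.symm⟩
  obtain ⟨a, b, hab, hf⟩ := key
  have hab' : (a : ℕ) < b := hab
  refine ⟨b - a, by omega, by have := b.2; omega,
    fun i => ⌊((b : ℕ) : ℝ) * z i⌋ - ⌊((a : ℕ) : ℝ) * z i⌋, fun i => ?_⟩
  have h1 : ⌊(M : ℝ) * Int.fract ((a : ℕ) * z i)⌋₊ = ⌊(M : ℝ) * Int.fract ((b : ℕ) * z i)⌋₊ :=
    congrArg Fin.val (congrFun hf i)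
  have ha := Nat.floor_le (mul_nonneg hM0.le (Int.fract_nonneg ((a : ℕ) * z i)))
  have hb := Nat.floor_le (mul_nonneg hM0.le (Int.fract_nonneg ((b : ℕ) * z i)))
  have ha' := Nat.lt_floor_add_one ((M : ℝ) * Int.fract ((a : ℕ) * z i))
  have hb' := Nat.lt_floor_add_one ((M : ℝ) * Int.fract ((b : ℕ) * z i))
  rw [h1] at ha ha'
  have e : (((b : ℕ) - (a : ℕ) : ℕ) : ℝ) * z i -
      ((⌊((b : ℕ) : ℝ) * z i⌋ - ⌊((a : ℕ) : ℝ) * z i⌋ : ℤ) : ℝ) =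
      Int.fract ((b : ℕ) * z i) - Int.fract ((a : ℕ) * z i) := by
    rw [Nat.cast_sub hab'.le, Int.fract, Int.fract]
    push_cast
    ring
  rw [e, abs_le]
  have h2 : (M : ℝ) * (1 / M) = 1 := by field_simp
  constructor
  · refine le_of_mul_le_mul_left ?_ hM0
    rw [mul_neg, h2]; linarith
  · refine le_of_mul_le_mul_left ?_ hM0
    rw [h2]; linarith

/-- The set is covered by intervals of length 2δ/β about the points m/β. At most βL + 2δ + 1
integers m occur, and δ ≤ 1/2 bounds this by βL + 2. -/
theorem volume_near_integers_le {p L β δ : ℝ} (hL : 0 ≤ L) (hβ : 0 < β) (hδ : 0 ≤ δ)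
    (hδ' : δ ≤ 1 / 2) :
    volume {x ∈ Ioc p (p + L) | ∃ m : ℤ, |β * x - m| ≤ δ} ≤
      ENNReal.ofReal ((L + 2 / β) * (2 * δ)) := by
  set I := Finset.Icc ⌈β * p - δ⌉ ⌊β * (p + L) + δ⌋ with hI
  have hsub : {x ∈ Ioc p (p + L) | ∃ m : ℤ, |β * x - m| ≤ δ} ⊆
      ⋃ m ∈ I, Icc (((m : ℝ) - δ) / β) (((m : ℝ) + δ) / β) := by
    rintro x ⟨⟨hx1, hx2⟩, m, hm⟩
    have hm' := abs_le.mp hm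
    have e1 : β * p < β * x := by gcongr
    have e2 : β * x ≤ β * (p + L) := by gcongr
    simp only [mem_iUnion]
    refine ⟨m, ?_, ?_⟩
    · rw [hI, Finset.mem_Icc, Int.ceil_le, Int.le_floor]
      constructor <;> linarith
    · rw [mem_Icc, div_le_iff₀ hβ, le_div_iff₀ hβ]
      constructor <;> linarith
  have hcard : (I.card : ℝ) ≤ β * L + 2 := by
    have h0 : 0 ≤ β * L := by positivity
    rw [hI, Int.card_Icc]
    have h1 := Int.floor_le (β * (p + L) + δ)
    have h2 := Int.le_ceil (β * p - δ)
    rcases le_total 0 (⌊β * (p + L) + δ⌋ + 1 - ⌈β * p - δ⌉) with h | h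
    · have h3 : ((⌊β * (p + L) + δ⌋ + 1 - ⌈β * p - δ⌉).toNat : ℝ) =
          ((⌊β * (p + L) + δ⌋ + 1 - ⌈β * p - δ⌉ : ℤ) : ℝ) := by
        exact_mod_cast Int.toNat_of_nonneg h
      rw [h3]
      push_cast
      linarith
    · rw [Int.toNat_of_nonpos h]
      push_cast
      linarith
  calc _ ≤ volume (⋃ m ∈ I, Icc (((m : ℝ) - δ) / β) (((m : ℝ) + δ) / β)) := measure_mono hsub
    _ ≤ ∑ m ∈ I, volume (Icc (((m : ℝ) - δ) / β) (((m : ℝ) + δ) / β)) :=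
        measure_biUnion_finset_le _ _
    _ = I.card * ENNReal.ofReal (2 * δ / β) := by
        rw [← nsmul_eq_mul, ← Finset.sum_const]
        refine Finset.sum_congr rfl fun m _ => ?_
        rw [Real.volume_Icc]
        congr 1
        ring
    _ = ENNReal.ofReal (I.card * (2 * δ / β)) := by
        rw [ENNReal.ofReal_mul (by positivity), ENNReal.ofReal_natCast]
    _ ≤ ENNReal.ofReal ((β * L + 2) * (2 * δ / β)) := by
        gcongr
    _ = _ := by congr 1; field_simp

/-- The points of the cube `(p, p + L]ⁿ` whose dilate by `β` is within `δ` of `ℤⁿ` in each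
coordinate. -/
def nearLattice (n : ℕ) (p L β δ : ℝ) : Set (Rn n) :=
  WithLp.ofLp ⁻¹' (univ.pi fun _ : Fin n => {x ∈ Ioc p (p + L) | ∃ m : ℤ, |β * x - m| ≤ δ})

theorem mem_nearLattice {n : ℕ} {p L β δ : ℝ} {x : Rn n} :
    x ∈ nearLattice n p L β δ ↔ x ∈ cube n p L ∧ ∀ i, ∃ m : ℤ, |β * x i - m| ≤ δ := by
  simp only [nearLattice, cube, mem_preimage, Set.mem_pi, mem_univ, true_implies, mem_sep_iff,
    forall_and]

theorem measurableSet_near_integers (p L β δ : ℝ) :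
    MeasurableSet {x ∈ Ioc p (p + L) | ∃ m : ℤ, |β * x - m| ≤ δ} := by
  refine measurableSet_Ioc.inter ?_
  have : {x : ℝ | ∃ m : ℤ, |β * x - m| ≤ δ} = ⋃ m : ℤ, {x | |β * x - m| ≤ δ} := by
    ext; simp
  change MeasurableSet {x : ℝ | ∃ m : ℤ, |β * x - m| ≤ δ}
  rw [this]
  refine MeasurableSet.iUnion fun m => IsClosed.measurableSet ?_
  exact isClosed_le (by fun_prop) continuous_const

theorem measurableSet_nearLattice (n : ℕ) (p L β δ : ℝ) :
    MeasurableSet (nearLattice n p L β δ) :=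
  (MeasurableSet.univ_pi fun _ => measurableSet_near_integers p L β δ).preimage
    (PiLp.volume_preserving_ofLp (Fin n)).measurable

theorem volume_nearLattice_le {n : ℕ} {p L β δ : ℝ} (hL : 0 ≤ L) (hβ : 0 < β) (hδ : 0 ≤ δ)
    (hδ' : δ ≤ 1 / 2) :
    volume (nearLattice n p L β δ) ≤ ENNReal.ofReal (((L + 2 / β) * (2 * δ)) ^ n) := by
  rw [nearLattice, (PiLp.volume_preserving_ofLp (Fin n)).measure_preimage
    (MeasurableSet.univ_pi fun _ => measurableSet_near_integers p L β δ).nullMeasurableSet,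
    volume_pi_pi, Finset.prod_const, Finset.card_univ, Fintype.card_fin,
    ENNReal.ofReal_pow (by positivity)]
  gcongr
  exact volume_near_integers_le hL hβ hδ hδ'

/-- The points of a cube at which `jαx` is far from `ℤⁿ` for all `1 ≤ j ≤ A`. -/
def wellSpreadSet (n : ℕ) (p L α δ : ℝ) (A : ℕ) : Set (Rn n) :=
  cube n p L \ ⋃ j ∈ Finset.range A, nearLattice n p L (((j : ℝ) + 1) * α) δ

theorem measurableSet_wellSpreadSet (n : ℕ) (p L α δ : ℝ) (A : ℕ) :
    MeasurableSet (wellSpreadSet n p L α δ A) :=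
  (measurableSet_cube n p L).diff
    (Finset.measurableSet_biUnion _ fun _ _ => measurableSet_nearLattice n _ _ _ _)

/-- A union bound over j. The term κ/(j + 1) is the boundary error of `volume_near_integers_le`
relative to L; it decays in j, so it is kept inside the sum. -/
theorem le_volume_wellSpreadSet {n : ℕ} {p L α δ κ : ℝ} {A : ℕ} (hL : 0 < L) (hα : 0 < α)
    (hδ : 0 ≤ δ) (hδ' : δ ≤ 1 / 2) (hκ : 2 / (α * L) ≤ κ)
    (hsum : (2 * δ) ^ n * ∑ j ∈ Finset.range A, (1 + κ / ((j : ℝ) + 1)) ^ n ≤ 3 / 4) :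
    ENNReal.ofReal (L ^ n / 4) ≤ volume (wellSpreadSet n p L α δ A) := by
  have hbad : volume (⋃ j ∈ Finset.range A, nearLattice n p L (((j : ℝ) + 1) * α) δ) ≤
      ENNReal.ofReal (3 / 4 * L ^ n) := by
    calc _ ≤ ∑ j ∈ Finset.range A, volume (nearLattice n p L (((j : ℝ) + 1) * α) δ) :=
          measure_biUnion_finset_le _ _
      _ ≤ ∑ j ∈ Finset.range A,
          ENNReal.ofReal (L ^ n * ((2 * δ) ^ n * (1 + κ / ((j : ℝ) + 1)) ^ n)) := by
          refine Finset.sum_le_sum fun j _ => ?_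
          refine (volume_nearLattice_le hL.le (by positivity) hδ hδ').trans ?_
          refine ENNReal.ofReal_le_ofReal ?_
          rw [← mul_pow, ← mul_pow]
          have h1 : L + 2 / (((j : ℝ) + 1) * α) = L * (1 + 2 / (α * L) / ((j : ℝ) + 1)) := by
            field_simp
          have h2 : L * (1 + 2 / (α * L) / ((j : ℝ) + 1)) ≤ L * (1 + κ / ((j : ℝ) + 1)) := by
            gcongr
          have h3 : 0 ≤ L + 2 / (((j : ℝ) + 1) * α) := by positivity
          refine pow_le_pow_left₀ (by positivity) ?_ n
          rw [h1]
          calc _ ≤ L * (1 + κ / ((j : ℝ) + 1)) * (2 * δ) := by gcongr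
            _ = _ := by ring
      _ = ENNReal.ofReal (L ^ n *
          ((2 * δ) ^ n * ∑ j ∈ Finset.range A, (1 + κ / ((j : ℝ) + 1)) ^ n)) := by
          have hκ0 : 0 ≤ κ := le_trans (by positivity) hκ
          rw [← ENNReal.ofReal_sum_of_nonneg fun j _ => by positivity, Finset.mul_sum,
            Finset.mul_sum]
      _ ≤ _ := by
          refine ENNReal.ofReal_le_ofReal ?_
          rw [mul_comm]
          gcongr
  have hfin : ENNReal.ofReal (3 / 4 * L ^ n) ≠ ∞ := ENNReal.ofReal_ne_top
  calc ENNReal.ofReal (L ^ n / 4) = ENNReal.ofReal (L ^ n) - ENNReal.ofReal (3 / 4 * L ^ n) := by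
        rw [← ENNReal.ofReal_sub _ (by positivity)]
        congr 1
        ring
    _ ≤ volume (cube n p L) -
        volume (⋃ j ∈ Finset.range A, nearLattice n p L (((j : ℝ) + 1) * α) δ) := by
        rw [volume_cube, ENNReal.ofReal_pow hL.le]
        exact tsub_le_tsub_left hbad _
    _ ≤ _ := le_measure_sdiff

/-- A parameter choice for the Diophantine argument: `M ≈ R^{(1-2σ)/n}` and `A ≈ 4⁻ⁿ R^{1-2σ}`. -/
theorem eventually_exists_parameters {n : ℕ} (hn : 1 ≤ n) {σ : ℝ} (hσ : σ < 1 / ((n : ℝ) + 2))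
    (κ E : ℝ) :
    ∀ᶠ R : ℝ in atTop, ∃ M A : ℕ, 2 ≤ M ∧ (M : ℝ) ^ n < R ^ (1 - 2 * σ) ∧ E * R ^ σ / M ≤ 1 / 6 ∧
      1 / 4 ^ n * R ^ (1 - 2 * σ) < A + 1 ∧
      (2 * (1 / (M : ℝ))) ^ n * ∑ j ∈ Finset.range A, (1 + κ / ((j : ℝ) + 1)) ^ n ≤ 3 / 4 := by
  have hn0 : (0 : ℝ) < n := by exact_mod_cast hn
  have hn1 : (1 : ℝ) ≤ n := by exact_mod_cast hn
  have hσ2 : σ * (n + 2) < 1 := by rwa [lt_div_iff₀ (by positivity)] at hσ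
  have h12 : 0 < 1 - 2 * σ := by nlinarith
  have hS : Tendsto (fun R : ℝ => R ^ ((1 - 2 * σ) / n)) atTop atTop :=
    tendsto_rpow_atTop (by positivity)
  have hQ : Tendsto (fun R : ℝ => R ^ (1 - 2 * σ)) atTop atTop := tendsto_rpow_atTop h12
  -- R^σ is negligible against M ≈ R^{(1-2σ)/n} because σ < (1-2σ)/n, which is the hypothesis σ(n +
  -- 2) < 1.
  have hneg : Tendsto (fun R : ℝ => 2 * E * R ^ (-((1 - 2 * σ) / n - σ))) atTop (𝓝 (2 * E * 0)) := by
    refine (tendsto_rpow_neg_atTop ?_).const_mul _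
    rw [sub_pos, lt_div_iff₀ hn0]
    linarith
  rw [mul_zero] at hneg
  have hratio : Tendsto (fun S : ℝ => (S / (S - 1)) ^ n) atTop (𝓝 1) := by
    have h1 : Tendsto (fun S : ℝ => 1 + (S - 1)⁻¹) atTop (𝓝 (1 + 0)) :=
      (tendsto_inv_atTop_zero.comp (tendsto_atTop_add_const_right _ (-1) tendsto_id)).const_add 1
    have h2 := h1.pow n
    rw [add_zero, one_pow] at h2
    refine h2.congr' ?_
    filter_upwards [eventually_gt_atTop 1] with S hS
    congr 1
    have : S - 1 ≠ 0 := by linarith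
    field_simp
    ring
  -- The summands tend to 1, so by Cesàro the boundary errors do not affect the leading order A of
  -- the sum.
  have hces : Tendsto (fun A : ℕ => (A : ℝ)⁻¹ *
      ∑ j ∈ Finset.range A, (1 + κ / ((j : ℝ) + 1)) ^ n) atTop (𝓝 1) := by
    refine Tendsto.cesaro ?_
    have h1 : Tendsto (fun j : ℕ => 1 + κ * (1 / ((j : ℝ) + 1))) atTop (𝓝 (1 + κ * 0)) :=
      (tendsto_one_div_add_atTop_nhds_zero_nat.const_mul κ).const_add 1
    have h2 := h1.pow n
    rw [mul_zero, add_zero, one_pow] at h2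
    refine h2.congr fun j => ?_
    rw [mul_one_div]
  have hA : Tendsto (fun R : ℝ => ⌊1 / 4 ^ n * R ^ (1 - 2 * σ)⌋₊) atTop atTop :=
    tendsto_nat_floor_atTop.comp (hQ.const_mul_atTop (by positivity))
  -- The tolerances 6/5 and 5/4 are chosen so that, with 2ⁿ/4ⁿ ≤ 1/2, the final product is 5/4 · 1/2
  -- · 6/5 = 3/4.
  filter_upwards [hS.eventually_ge_atTop 4, hneg.eventually_le_const (by norm_num : (0 : ℝ) < 1 / 6),
    hS.eventually (hratio.eventually_le_const (by norm_num : (1 : ℝ) < 6 / 5)),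
    hA.eventually (hces.eventually_le_const (by norm_num : (1 : ℝ) < 5 / 4)),
    hA.eventually_gt_atTop 0, eventually_gt_atTop 0] with R hS4 hsmall hrat hcesR hApos hR
  set S := R ^ ((1 - 2 * σ) / n) with hSdef
  set Q := R ^ (1 - 2 * σ) with hQdef
  set A := ⌊1 / 4 ^ n * Q⌋₊ with hAdef
  have hSQ : S ^ n = Q := by
    rw [hSdef, ← Real.rpow_natCast, ← Real.rpow_mul hR.le]
    congr 1
    field_simp
  have hQ0 : 0 < Q := Real.rpow_pos_of_pos hR _
  -- The ceiling minus one gives M < S strictly, hence Mⁿ < Q, so that the rescaled time j/Q stays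
  -- below 1.
  set M := ⌈S⌉₊ - 1 with hMdef
  have hceil : 4 ≤ ⌈S⌉₊ := by
    have := Nat.le_ceil S
    exact_mod_cast hS4.trans this
  have hMcast : (M : ℝ) = ⌈S⌉₊ - 1 := by
    rw [hMdef, Nat.cast_sub (by omega)]; simp
  have hM1 : S - 1 ≤ M := by
    rw [hMcast]; linarith [Nat.le_ceil S]
  have hM2 : (M : ℝ) < S := by
    rw [hMcast]; linarith [Nat.ceil_lt_add_one (by linarith : 0 ≤ S)]
  have hM0 : (0 : ℝ) < M := by linarith
  refine ⟨M, A, by omega, ?_, ?_, Nat.lt_floor_add_one _, ?_⟩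
  · rw [← hSQ]
    exact pow_lt_pow_left₀ hM2 hM0.le (by omega)
  · have hRS : R ^ (-((1 - 2 * σ) / n - σ)) = R ^ σ / S := by
      rw [hSdef, ← Real.rpow_sub hR]; congr 1; ring
    rw [hRS] at hsmall
    rw [div_le_iff₀ hM0]
    rw [← mul_div_assoc, div_le_iff₀ (by linarith)] at hsmall
    linarith
  · have hAQ : (A : ℝ) ≤ 1 / 4 ^ n * Q := Nat.floor_le (by positivity)
    have hA0 : (0 : ℝ) < A := by exact_mod_cast hApos
    have h1 : ∑ j ∈ Finset.range A, (1 + κ / ((j : ℝ) + 1)) ^ n ≤ 5 / 4 * A := by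
      rw [inv_mul_le_iff₀ hA0] at hcesR
      linarith
    have h2 : Q / (M : ℝ) ^ n ≤ 6 / 5 := by
      rw [← hSQ, ← div_pow]
      refine le_trans ?_ hrat
      have : 0 < S - 1 := by linarith
      gcongr
    have h3 : (2 : ℝ) ^ n / 4 ^ n ≤ 1 / 2 := by
      rw [← div_pow]
      calc ((2 : ℝ) / 4) ^ n ≤ ((2 : ℝ) / 4) ^ 1 :=
            pow_le_pow_of_le_one (by norm_num) (by norm_num) hn
        _ = 1 / 2 := by norm_num
    calc (2 * (1 / (M : ℝ))) ^ n * ∑ j ∈ Finset.range A, (1 + κ / ((j : ℝ) + 1)) ^ n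
        ≤ (2 * (1 / (M : ℝ))) ^ n * (5 / 4 * (1 / 4 ^ n * Q)) := by
          gcongr
          exact h1.trans (by gcongr)
      _ = 5 / 4 * ((2 : ℝ) ^ n / 4 ^ n) * (Q / (M : ℝ) ^ n) := by
          rw [mul_pow, one_div_pow]; field_simp
      _ ≤ 5 / 4 * (1 / 2) * (6 / 5) := by gcongr
      _ = 3 / 4 := by norm_num

/-! ### Constructive interference and the size of the maximal function -/

/-- The deviation from 1 is at most 1/2 + (1/6)(3/2) = 3/4. -/
theorem quarter_le_re_exp_mul {φ : ℝ} {w : ℂ} (hφ : |φ| ≤ 1 / 6) (hw : ‖w - 1‖ < 1 / 2) :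
    1 / 4 ≤ (Complex.exp (Complex.I * φ) * w).re := by
  have h1 : ‖Complex.exp (Complex.I * φ) - 1‖ ≤ 1 / 6 :=
    (Real.norm_exp_I_mul_ofReal_sub_one_le).trans hφ
  have h2 : ‖w‖ ≤ 3 / 2 := by
    calc ‖w‖ = ‖(w - 1) + 1‖ := by ring_nf
      _ ≤ ‖w - 1‖ + ‖(1 : ℂ)‖ := norm_add_le _ _
      _ ≤ _ := by rw [norm_one]; linarith
  have h3 : ‖(w - 1) + (Complex.exp (Complex.I * φ) - 1) * w‖ ≤ 3 / 4 := by
    refine (norm_add_le _ _).trans ?_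
    rw [norm_mul]
    have := mul_le_mul h1 h2 (norm_nonneg _) (by norm_num)
    linarith
  have h4 : Complex.exp (Complex.I * φ) * w =
      1 + ((w - 1) + (Complex.exp (Complex.I * φ) - 1) * w) := by ring
  rw [h4, Complex.add_re, Complex.one_re]
  have := (abs_le.mp ((Complex.abs_re_le_norm _).trans h3)).1
  linarith

/-- The phase at a frequency `q k` is small modulo `2π` at a point well approximated by a
lattice. -/
theorem exists_small_phase {n : ℕ} {ε₁ R σ α s : ℝ} {M j : ℕ} (hR : 0 < R)
    (hα : α = R ^ (σ - 1) / (2 * Real.pi)) (hs : s = j / (2 * Real.pi * R * R ^ (1 - 2 * σ)))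
    (hM : 0 < M) (hsmall : (2 * Real.pi * n * ε₁) * R ^ σ / M ≤ 1 / 6)
    {x : Rn n} {m : Fin n → ℤ} (hm : ∀ i, |j * (α * x i) - m i| ≤ 1 / M)
    {ξ' : Rn n} (hξ' : ξ' ∈ freqFinset n σ ε₁ R hR) :
    ∃ φ : ℝ, |φ| ≤ 1 / 6 ∧
      Complex.exp (Complex.I * ((2 * Real.pi * ⟪s • x, ξ'⟫ -
        4 * Real.pi ^ 2 * s * ‖ξ'‖ ^ 2 : ℝ) : ℂ)) = Complex.exp (Complex.I * φ) := by
  have hpi := Real.pi_pos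
  have hM0 : (0 : ℝ) < M := by exact_mod_cast hM
  obtain ⟨k, rfl⟩ := exists_of_mem_freqFinset hξ'
  have hlt := norm_lt_of_mem_freqFinset hξ'
  set q := R ^ (1 - σ) with hq
  have hq0 : 0 < q := Real.rpow_pos_of_pos hR _
  have hQ : R * R ^ (1 - 2 * σ) = q ^ 2 := by
    rw [hq, ← Real.rpow_natCast, ← Real.rpow_mul hR.le]
    nth_rewrite 1 [← Real.rpow_one R]
    rw [← Real.rpow_add hR]
    congr 1
    push_cast
    ring
  have hα' : α = 1 / (2 * Real.pi * q) := by
    have : R ^ (σ - 1) = q⁻¹ := by rw [hq, ← Real.rpow_neg hR.le]; congr 1; ring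
    rw [hα, this]; field_simp
  have hs' : s = j / (2 * Real.pi * q ^ 2) := by rw [hs, ← hQ]; ring_nf
  have hk : ∀ i, |(k i : ℝ)| ≤ ε₁ * R ^ σ := by
    intro i
    have h2 := (PiLp.norm_apply_le
      (WithLp.toLp 2 fun i => q * (k i : ℝ) : Rn n) i).trans hlt.le
    simp only [Real.norm_eq_abs, abs_mul, abs_of_pos hq0] at h2
    refine le_of_mul_le_mul_left (h2.trans_eq ?_) hq0
    conv_lhs => rw [← rpow_one_sub_mul_rpow hR σ]
    ring
  refine ⟨2 * Real.pi * ∑ i, (j * (α * x i) - m i) * k i, ?_, ?_⟩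
  · rw [abs_mul, abs_of_pos (by positivity : 0 < 2 * Real.pi)]
    calc 2 * Real.pi * |∑ i, (j * (α * x i) - m i) * k i|
        ≤ 2 * Real.pi * ∑ _i : Fin n, 1 / M * (ε₁ * R ^ σ) := by
          gcongr
          refine (Finset.abs_sum_le_sum_abs _ _).trans (Finset.sum_le_sum fun i _ => ?_)
          rw [abs_mul]
          exact mul_le_mul (hm i) (hk i) (abs_nonneg _) (by positivity)
      _ = (2 * Real.pi * n * ε₁) * R ^ σ / M := by
          rw [Finset.sum_const, Finset.card_univ, Fintype.card_fin, nsmul_eq_mul]; ring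
      _ ≤ _ := hsmall
  · have e1 : ⟪s • x, (WithLp.toLp 2 fun i => q * (k i : ℝ) : Rn n)⟫ =
        ∑ i, j * (α * x i) * k i := by
      rw [inner_smul_left, PiLp.inner_apply, Finset.mul_sum]
      refine Finset.sum_congr rfl fun i _ => ?_
      simp only [conj_trivial, RCLike.inner_apply]
      rw [hs', hα']
      field_simp
    have e2 : ‖(WithLp.toLp 2 fun i => q * (k i : ℝ) : Rn n)‖ ^ 2 = q ^ 2 * ∑ i, (k i : ℝ) ^ 2 := by
      rw [EuclideanSpace.norm_sq_eq, Finset.mul_sum]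
      refine Finset.sum_congr rfl fun i _ => ?_
      rw [Real.norm_eq_abs, sq_abs]
      ring
    -- With s = j/(2πq²) the quadratic phase is 2πj|k|². Together with 2πm·k it is an integer
    -- multiple of 2π and disappears, leaving only the approximation error.
    have e3 : 2 * Real.pi * ∑ i, j * (α * x i) * k i -
        4 * Real.pi ^ 2 * s * (q ^ 2 * ∑ i, (k i : ℝ) ^ 2) =
        2 * Real.pi * ∑ i, (j * (α * x i) - m i) * k i +
          ((∑ i, m i * k i - j * ∑ i, k i ^ 2 : ℤ) : ℝ) * (2 * Real.pi) := by
      have : 4 * Real.pi ^ 2 * s * (q ^ 2 * ∑ i, (k i : ℝ) ^ 2) =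
          2 * Real.pi * (j * ∑ i, (k i : ℝ) ^ 2) := by
        rw [hs']; field_simp; ring
      rw [this]
      push_cast
      simp only [sub_mul, Finset.sum_sub_distrib]
      ring
    rw [e1, e2, e3, Complex.ofReal_add, mul_add, Complex.exp_add]
    have e4 : Complex.I * ((((∑ i, m i * k i - j * ∑ i, k i ^ 2 : ℤ) : ℝ) * (2 * Real.pi) : ℝ) : ℂ) =
        ((∑ i, m i * k i - j * ∑ i, k i ^ 2 : ℤ) : ℂ) * (2 * Real.pi * Complex.I) := by
      push_cast; ring
    rw [e4, Complex.exp_int_mul_two_pi_mul_I, mul_one]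

/-- Constructive interference: `|e^{isΔ}u₀|` is comparable to the number of frequencies. -/
theorem card_div_four_le_norm_schrodingerFlow {n : ℕ} {θ : 𝓢(Rn n, ℂ)} {ε₁ R σ α s : ℝ} {M j : ℕ}
    (hR : 0 < R)
    (hadm : ∀ x ∈ annulus n (1 / 4 ^ (n + 2)) (2 * √(n : ℝ)), ∀ t ∈ Ioo (0 : ℝ) 1,
      ∀ ξ' : Rn n, ‖ξ'‖ ≤ ε₁ * R →
        ‖(∫ ξ : Rn n, Complex.exp (Complex.I *
            ((2 * Real.pi * (⟪x - (2 * t / R) • ξ', ξ⟫ - t / R * ‖ξ‖ ^ 2) : ℝ) : ℂ)) * θ ξ) - 1‖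
          < 1 / 2)
    (hα : α = R ^ (σ - 1) / (2 * Real.pi)) (hs : s = j / (2 * Real.pi * R * R ^ (1 - 2 * σ)))
    (hM : 0 < M) (hj : 0 < j) (hjQ : (j : ℝ) < R ^ (1 - 2 * σ))
    (hsmall : (2 * Real.pi * n * ε₁) * R ^ σ / M ≤ 1 / 6)
    {x : Rn n} {m : Fin n → ℤ} (hm : ∀ i, |j * (α * x i) - m i| ≤ 1 / M)
    (hx : s • x ∈ annulus n (1 / 4 ^ (n + 2)) (2 * √(n : ℝ))) :
    ((freqFinset n σ ε₁ R hR).card : ℝ) / 4 ≤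
      ‖schrodingerFlow (latticeData θ σ ε₁ R) s (s • x)‖ := by
  have hpi := Real.pi_pos
  have hj0 : (0 : ℝ) < j := by exact_mod_cast hj
  set Q := R ^ (1 - 2 * σ) with hQ
  have hQ0 : 0 < Q := Real.rpow_pos_of_pos hR _
  -- The admissibility time t = j/Q matches the flow time through 4πs = 2t/R and 4π²s = 2πt/R.
  have ht : (j : ℝ) / Q ∈ Ioo (0 : ℝ) 1 := ⟨by positivity, (div_lt_one hQ0).mpr hjQ⟩
  refine le_trans ?_ (Complex.re_le_norm _)
  rw [schrodingerFlow_latticeData θ σ ε₁ hR, Complex.re_sum, div_eq_mul_one_div, ← nsmul_eq_mul]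
  refine Finset.card_nsmul_le_sum _ _ _ fun ξ' hξ' => ?_
  obtain ⟨φ, hφ, hexp⟩ := exists_small_phase hR hα hs hM hsmall hm hξ'
  rw [hexp]
  refine quarter_le_re_exp_mul hφ ?_
  have := hadm _ hx _ ht ξ' (norm_lt_of_mem_freqFinset hξ').le
  have e1 : 4 * Real.pi * s = 2 * (j / Q) / R := by rw [hs]; field_simp; ring
  have e2 : ∀ ξ : Rn n, 2 * Real.pi * ⟪s • x - (4 * Real.pi * s) • ξ', ξ⟫ -
      4 * Real.pi ^ 2 * s * ‖ξ‖ ^ 2 =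
      2 * Real.pi * (⟪s • x - (2 * (j / Q) / R) • ξ', ξ⟫ - j / Q / R * ‖ξ‖ ^ 2) := by
    intro ξ
    rw [← e1, mul_sub]
    congr 1
    rw [hs]; field_simp; ring
  simp only [e2]
  exact this

theorem norm_pseudoconformal {n : ℕ} (u : ℝ → Rn n → ℂ) {t : ℝ} (ht : 0 < t) (x : Rn n) :
    ‖pseudoconformal u t x‖ = 1 / t ^ ((n : ℝ) / 2) * ‖u (1 / t) (t⁻¹ • x)‖ := by
  rw [pseudoconformal, norm_mul, norm_mul, Complex.norm_exp_I_mul_ofReal, mul_one, RCLike.norm_conj,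
    Complex.norm_real, Real.norm_eq_abs, abs_of_pos (by positivity)]

/-- For large `R` there is a set of measure comparable to `Rⁿ` in the ball of radius `R` on which
the maximal function is large. -/
theorem eventually_exists_large_maximalFn {n : ℕ} (hn : 1 ≤ n) {σ : ℝ}
    (hσ : σ < 1 / ((n : ℝ) + 2)) {θ : 𝓢(Rn n, ℂ)} {ε₁ : ℝ} (hadm : IsAdmissible θ ε₁) :
    ∀ᶠ R : ℝ in atTop, 1 ≤ R ^ σ → ∃ G : Set (Rn n), MeasurableSet G ∧ G ⊆ Metric.ball 0 R ∧
      ENNReal.ofReal ((1 / (4 * √(n : ℝ))) ^ n / 4 * R ^ n) ≤ volume G ∧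
      ∀ x ∈ G, ENNReal.ofReal ((2 * Real.pi * 4 ^ n) ^ (-((n : ℝ) / 2)) * (ε₁ / √(n : ℝ)) ^ n / 4 *
        R ^ (σ * n - (n : ℝ) / 2)) ≤
        maximalFn (latticeTransform θ σ ε₁ R) (2 * Real.pi * 4 ^ n * R) x := by
  have hpi := Real.pi_pos
  have hn1 : (1 : ℝ) ≤ n := by exact_mod_cast hn
  have hn0 : 1 ≤ √(n : ℝ) := Real.one_le_sqrt.mpr hn1
  obtain ⟨hε, hadm⟩ := hadm
  filter_upwards [hadm, eventually_gt_atTop 0,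
    eventually_exists_parameters hn hσ (16 * Real.pi * √(n : ℝ)) (2 * Real.pi * n * ε₁)] with
    R hadm hR ⟨M, A, hM2, hMQ, hsmall, hAQ, hsum⟩ hRσ
  have hM0 : (0 : ℝ) < M := by exact_mod_cast (by omega : 0 < M)
  have hMinv : 1 / (M : ℝ) ≤ 1 / 2 := by
    gcongr; exact_mod_cast hM2
  set α := R ^ (σ - 1) / (2 * Real.pi) with hα
  have hα0 : 0 < α := div_pos (Real.rpow_pos_of_pos hR _) (by positivity)
  -- This corner and side place the cube in the shell R/2 ≤ |x| ≤ 3R/4.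
  set p := R / (2 * √(n : ℝ)) with hp
  set L := R / (4 * √(n : ℝ)) with hL
  have hp0 : 0 < p := by positivity
  have hL0 : 0 < L := by positivity
  set Q := R ^ (1 - 2 * σ) with hQ
  have hQ0 : 0 < Q := Real.rpow_pos_of_pos hR _
  have hlow : ∀ x ∈ cube n p L, R / 2 ≤ ‖x‖ := by
    intro x hx
    rw [mem_cube] at hx
    refine le_trans (le_of_eq ?_) (sqrt_mul_le_norm hp0.le fun i => (hx i).1.le.trans (le_abs_self _))
    rw [hp]; field_simp
  have hup : ∀ x ∈ cube n p L, ‖x‖ < R := by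
    intro x hx
    rw [mem_cube] at hx
    have h1 : ‖x‖ ≤ √(n : ℝ) * (p + L) := by
      refine norm_le_sqrt_mul (by positivity) fun i => ?_
      rw [abs_of_pos (by linarith [(hx i).1])]
      exact (hx i).2
    have h2 : √(n : ℝ) * (p + L) = 3 / 4 * R := by rw [hp, hL]; field_simp; ring
    linarith
  refine ⟨wellSpreadSet n p L α (1 / M) A, measurableSet_wellSpreadSet _ _ _ _ _ _, ?_, ?_, ?_⟩
  · intro x hx
    rw [mem_ball_zero_iff]
    exact hup x hx.1
  · refine le_trans (ENNReal.ofReal_le_ofReal (le_of_eq ?_))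
      (le_volume_wellSpreadSet (κ := 16 * Real.pi * √(n : ℝ)) hL0 hα0 (by positivity) hMinv ?_ hsum)
    · rw [hL, div_mul_eq_mul_div, ← mul_pow]; congr 2; ring
    · have h1 : α * L = R ^ σ / (8 * Real.pi * √(n : ℝ)) := by
        have : R ^ (σ - 1) * R = R ^ σ := by
          nth_rewrite 2 [← Real.rpow_one R]
          rw [← Real.rpow_add hR]; congr 1; ring
        rw [hα, hL, ← this]; field_simp; ring
      rw [h1, div_le_iff₀ (by positivity)]
      have h2 : 16 * Real.pi * √(n : ℝ) * (R ^ σ / (8 * Real.pi * √(n : ℝ))) = 2 * R ^ σ := by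
        field_simp; ring
      rw [h2]; linarith
  · rintro x ⟨hxc, hxb⟩
    obtain ⟨j, hj, hjM, m, hm⟩ := exists_simultaneous_approx (by omega : 0 < M) fun i => α * x i
    have hj0 : (0 : ℝ) < j := by exact_mod_cast hj
    have hjQ : (j : ℝ) < Q := lt_of_le_of_lt (by exact_mod_cast hjM) hMQ
    -- A Dirichlet denominator j ≤ A would put x in an excluded set, whose index is j - 1 because
    -- the union is indexed from zero.
    have hjA : A + 1 ≤ j := by
      by_contra hlt
      refine hxb (mem_iUnion₂.mpr ⟨j - 1, Finset.mem_range.mpr (by omega), ?_⟩)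
      refine mem_nearLattice.mpr ⟨hxc, fun i => ⟨m i, ?_⟩⟩
      have : ((j - 1 : ℕ) : ℝ) + 1 = j := by
        rw [Nat.cast_sub hj]; simp
      rw [this, mul_assoc]
      exact hm i
    have hjlow : 1 / 4 ^ n * Q < j := hAQ.trans_le (by exact_mod_cast hjA)
    set s := (j : ℝ) / (2 * Real.pi * R * Q) with hs
    have hs0 : 0 < s := by positivity
    -- The maximal function is tested at t = s⁻¹ = 2πRQ/j; j > 4⁻ⁿQ bounds it by KR with K = 2π4ⁿ.
    have hsinv : s⁻¹ ≤ 2 * Real.pi * 4 ^ n * R := by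
      rw [hs, inv_div, div_le_iff₀ hj0]
      have : Q ≤ 4 ^ n * j := by
        rw [one_div, inv_mul_lt_iff₀ (by positivity)] at hjlow
        exact hjlow.le
      calc 2 * Real.pi * R * Q ≤ 2 * Real.pi * R * (4 ^ n * j) := by gcongr
        _ = _ := by ring
    -- Since 4⁻ⁿQ < j < Q and R/2 ≤ |x| < R, the norm lies between 4⁻ⁿ/(4π) and 1/(2π); π < 4 turns
    -- the lower bound into 4^{-n-2}.
    have hann : s • x ∈ annulus n (1 / 4 ^ (n + 2)) (2 * √(n : ℝ)) := by
      have hnorm : ‖s • x‖ = s * ‖x‖ := by rw [norm_smul, Real.norm_eq_abs, abs_of_pos hs0]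
      constructor
      · rw [hnorm]
        calc (1 : ℝ) / 4 ^ (n + 2) = 1 / 4 ^ n / (4 * 4) := by rw [pow_add]; field_simp
          _ < 1 / 4 ^ n / (4 * Real.pi) := by
              gcongr
              exact Real.pi_lt_four
          _ = 1 / 4 ^ n * Q / (2 * Real.pi * R * Q) * (R / 2) := by field_simp; norm_num
          _ ≤ s * ‖x‖ := by
              rw [hs]
              gcongr
              exact hlow x hxc
      · rw [hnorm]
        have h1 : s * ‖x‖ ≤ 1 := by
          calc s * ‖x‖ ≤ Q / (2 * Real.pi * R * Q) * R := by
                rw [hs]; gcongr; exact (hup x hxc).le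
            _ = 1 / (2 * Real.pi) := by field_simp
            _ ≤ 1 := by
                rw [div_le_one (by positivity)]
                linarith [Real.pi_gt_three]
        linarith
    have hflow := card_div_four_le_norm_schrodingerFlow (θ := θ) hR hadm hα hs (by omega) hj hjQ
      hsmall hm hann
    have hcard := le_card_freqFinset hn σ hR hε
    have hv : (2 * Real.pi * 4 ^ n) ^ (-((n : ℝ) / 2)) * (ε₁ / √(n : ℝ)) ^ n / 4 *
        R ^ (σ * n - (n : ℝ) / 2) ≤ ‖latticeTransform θ σ ε₁ R s⁻¹ x‖ := by
      rw [latticeTransform, norm_pseudoconformal _ (inv_pos.mpr hs0), one_div s⁻¹, inv_inv]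
      have h1 : (2 * Real.pi * 4 ^ n * R) ^ (-((n : ℝ) / 2)) ≤ 1 / (s⁻¹) ^ ((n : ℝ) / 2) := by
        rw [Real.rpow_neg (by positivity), one_div]
        gcongr
      have h2 : R ^ (σ * n - (n : ℝ) / 2) = R ^ (-((n : ℝ) / 2)) * (R ^ σ) ^ n := by
        rw [← Real.rpow_natCast (R ^ σ), ← Real.rpow_mul hR.le, ← Real.rpow_add hR]
        congr 1; ring
      calc _ = (2 * Real.pi * 4 ^ n * R) ^ (-((n : ℝ) / 2)) *
            ((ε₁ * R ^ σ / √(n : ℝ)) ^ n / 4) := by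
            have h3 : (ε₁ * R ^ σ / √(n : ℝ)) ^ n = (ε₁ / √(n : ℝ)) ^ n * (R ^ σ) ^ n := by
              rw [← mul_pow]; congr 1; ring
            rw [h2, h3, Real.mul_rpow (by positivity) hR.le]; ring
        _ ≤ _ := by
            refine mul_le_mul h1 (le_trans ?_ hflow) (by positivity) (by positivity)
            gcongr
    calc _ ≤ ENNReal.ofReal ‖latticeTransform θ σ ε₁ R s⁻¹ x‖ := ENNReal.ofReal_le_ofReal hv
      _ = ‖latticeTransform θ σ ε₁ R s⁻¹ x‖ₑ := ofReal_norm _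
      _ ≤ _ := le_iSup₂ (f := fun t (_ : t ∈ Ioc (0 : ℝ) (2 * Real.pi * 4 ^ n * R)) =>
          ‖latticeTransform θ σ ε₁ R t x‖ₑ) s⁻¹ ⟨inv_pos.mpr hs0, hsinv⟩

/-- Chebyshev's inequality by comparison with an indicator. Only G has to be measurable, so it
applies directly to the maximal function, an uncountable supremum. -/
theorem const_le_eLpNorm_two_of_le {α : Type*} [MeasurableSpace α] {μ : Measure α}
    {f : α → ℝ≥0∞} {G : Set α} (hG : MeasurableSet G) {a : ℝ≥0∞} (hf : ∀ x ∈ G, a ≤ f x) :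
    a * μ G ^ ((1 : ℝ) / 2) ≤ eLpNorm f 2 μ := by
  have h := eLpNorm_indicator_const (c := a) (p := 2) (μ := μ) hG (by norm_num) (by norm_num)
  rw [enorm_eq_self] at h
  norm_num at h
  norm_num
  rw [← h]
  refine eLpNorm_mono_enorm fun x => ?_
  by_cases hx : x ∈ G
  · simpa [hx] using hf x hx
  · simp [hx]

end

/-! ### Assembly of the estimates -/

theorem proposition11 (n : ℕ) (hn : 1 ≤ n) (σ : ℝ) (hσ : σ < 1 / ((n : ℝ) + 2))
    (θ : 𝓢(Rn n, ℂ)) (hθ : IsProfile θ) :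
    (∃ ε₁ : ℝ, IsAdmissible θ ε₁) ∧
    ∀ ε₁ : ℝ, IsAdmissible θ ε₁ →
      ∃ K c C : ℝ, 0 < K ∧ 0 < c ∧ 0 < C ∧
        ∀ᶠ R : ℝ in atTop, (∃ m : ℤ, R ^ σ = (m : ℝ)) →
          ∃ v₀ : 𝓢(Rn n, ℂ),
            HasInitialData (latticeTransform θ σ ε₁ R) v₀ ∧
            ENNReal.ofReal (c * R ^ (n : ℝ)) ≤
              volume {x : Rn n | x ∈ Metric.ball (0 : Rn n) R ∧
                ENNReal.ofReal (c * R ^ (σ * n - (n : ℝ) / 2)) ≤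
                  maximalFn (latticeTransform θ σ ε₁ R) (K * R) x} ∧
            (ENNReal.ofReal (c * R ^ (σ * n / 2)) ≤ eLpNorm v₀ 2 volume ∧
              eLpNorm v₀ 2 volume ≤ ENNReal.ofReal (C * R ^ (σ * n / 2))) ∧
            ENNReal.ofReal (c * R ^ (σ * n / 2)) ≤
              eLpNorm (maximalFn (latticeTransform θ σ ε₁ R) (K * R)) 2
                (volume.restrict (Metric.ball (0 : Rn n) R)) / eLpNorm v₀ 2 volume ∧
            (tsupport (𝓕 v₀ : 𝓢(Rn n, ℂ)) ⊆
                (1 / (4 * Real.pi) : ℝ) • tsupport (latticeData θ σ ε₁ R) ∧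
              (1 / (4 * Real.pi) : ℝ) • tsupport (latticeData θ σ ε₁ R) ⊆
                annulus n (1 / (4 ^ (n + 4) * Real.pi)) (√(n : ℝ) / Real.pi)) := by
  refine ⟨exists_isAdmissible hθ, fun ε₁ hadm => ?_⟩
  have hε : 0 < ε₁ := hadm.1
  have hpi := Real.pi_pos
  have hn0 : 0 < √(n : ℝ) := Real.sqrt_pos.mpr (by exact_mod_cast hn)
  have hσ1 : σ < 1 := by
    refine hσ.trans_le ((div_le_one (by positivity)).mpr ?_)
    have : (0 : ℝ) ≤ n := by positivity
    linarith
  obtain ⟨c₁, C, hc₁, hC, hL2⟩ := exists_eLpNorm_latticeData_bounds hn hθ hσ1 hε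
  set c₂ : ℝ := (1 / (4 * √(n : ℝ))) ^ n / 4 with hc₂
  set c₃ : ℝ := (2 * Real.pi * 4 ^ n) ^ (-((n : ℝ) / 2)) * (ε₁ / √(n : ℝ)) ^ n / 4 with hc₃
  have hc₂0 : 0 < c₂ := by positivity
  have hc₃0 : 0 < c₃ := by positivity
  -- Height c₃R^{σn-n/2} on a set of measure c₂Rⁿ gives L² norm at least c₃√c₂R^{σn}; dividing by
  -- the upper bound CR^{σn/2} leaves c₄R^{σn/2}.
  set c₄ : ℝ := c₃ * √c₂ / C with hc₄
  have hc₄0 : 0 < c₄ := by positivity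
  refine ⟨2 * Real.pi * 4 ^ n, min (min c₁ c₂) (min c₃ c₄), C, by positivity,
    lt_min (lt_min hc₁ hc₂0) (lt_min hc₃0 hc₄0), hC, ?_⟩
  set c := min (min c₁ c₂) (min c₃ c₄) with hc
  have hcc₁ : c ≤ c₁ := (min_le_left _ _).trans (min_le_left _ _)
  have hcc₂ : c ≤ c₂ := (min_le_left _ _).trans (min_le_right _ _)
  have hcc₃ : c ≤ c₃ := (min_le_right _ _).trans (min_le_left _ _)
  have hcc₄ : c ≤ c₄ := (min_le_right _ _).trans (min_le_right _ _)
  filter_upwards [hL2, eventually_exists_large_maximalFn hn hσ hadm, eventually_gt_atTop 0] with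
    R hL2 hmax hR ⟨m, hm⟩
  -- A positive integer is at least 1.
  have hRσ : 1 ≤ R ^ σ := by
    have h0 : 0 < R ^ σ := Real.rpow_pos_of_pos hR _
    rw [hm] at h0 ⊢
    exact_mod_cast h0
  obtain ⟨hlo, hhi⟩ := hL2 hRσ
  obtain ⟨G, hGm, hGball, hGvol, hGmax⟩ := hmax hRσ
  have hv₀ := eLpNorm_pseudoconformalData (latticeData θ σ ε₁ R)
  refine ⟨pseudoconformalData (latticeData θ σ ε₁ R), hasInitialData_pseudoconformal _, ?_,
    ⟨?_, ?_⟩, ?_, tsupport_fourier_pseudoconformalData _, smul_tsupport_latticeData_subset hθ σ ε₁ hR⟩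
  · rw [Real.rpow_natCast]
    calc ENNReal.ofReal (c * R ^ n) ≤ ENNReal.ofReal (c₂ * R ^ n) := by gcongr
      _ ≤ volume G := hGvol
      _ ≤ _ := by
          refine measure_mono fun x hx => ?_
          exact ⟨hGball hx, le_trans (by gcongr) (hGmax x hx)⟩
  · rw [hv₀]
    exact le_trans (by gcongr) hlo
  · rw [hv₀]
    exact hhi
  · rw [hv₀]
    refine ENNReal.le_div_iff_mul_le (Or.inl ?_) (Or.inl ?_) |>.mpr ?_
    · exact (lt_of_lt_of_le (ENNReal.ofReal_pos.mpr (by positivity)) hlo).ne'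
    · exact ne_top_of_le_ne_top ENNReal.ofReal_ne_top hhi
    have hGr : volume.restrict (Metric.ball (0 : Rn n) R) G = volume G := by
      rw [Measure.restrict_apply hGm, inter_eq_left.mpr hGball]
    have key := const_le_eLpNorm_two_of_le (μ := volume.restrict (Metric.ball (0 : Rn n) R)) hGm hGmax
    rw [hGr] at key
    calc ENNReal.ofReal (c * R ^ (σ * n / 2)) * eLpNorm (latticeData θ σ ε₁ R) 2 volume
        ≤ ENNReal.ofReal (c₄ * R ^ (σ * n / 2)) * ENNReal.ofReal (C * R ^ (σ * n / 2)) := by gcongr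
      _ = ENNReal.ofReal (c₃ * R ^ (σ * n - (n : ℝ) / 2)) *
          ENNReal.ofReal (c₂ * R ^ n) ^ ((1 : ℝ) / 2) := by
          rw [ENNReal.ofReal_rpow_of_nonneg (by positivity) (by norm_num),
            ← ENNReal.ofReal_mul (by positivity), ← ENNReal.ofReal_mul (by positivity)]
          congr 1
          have h1 : (c₂ * R ^ n) ^ ((1 : ℝ) / 2) = √c₂ * R ^ ((n : ℝ) / 2) := by
            rw [Real.mul_rpow hc₂0.le (by positivity), ← Real.sqrt_eq_rpow, ← Real.rpow_natCast,
              ← Real.rpow_mul hR.le]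
            congr 2; ring
          have h2 : R ^ (σ * n - (n : ℝ) / 2) * R ^ ((n : ℝ) / 2) =
              R ^ (σ * n / 2) * R ^ (σ * n / 2) := by
            rw [← Real.rpow_add hR, ← Real.rpow_add hR]; congr 1; ring
          rw [h1, hc₄]
          calc _ = c₃ * √c₂ * (R ^ (σ * n / 2) * R ^ (σ * n / 2)) := by field_simp
            _ = _ := by rw [← h2]; ring
      _ ≤ ENNReal.ofReal (c₃ * R ^ (σ * n - (n : ℝ) / 2)) * volume G ^ ((1 : ℝ) / 2) := by
          gcongr
      _ ≤ _ := key
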